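/- Let $l \ge 2$ be an integer and let $L_{rel}$ be a first-order language (with equality) whose vocabulary consists of finitely many relation symbols $R_1, \dots, R_\rho$, where $\rho \ge 1$ and each $R_k$ has arity $r_k \ge 2$; there are no constant or function symbols. Write $[n] = \{1, \dots, n\}$. An *$l$-colouring* of an $L_{rel}$-structure $\mathcal{M}$ with universe $M$ is a function $\gamma : M \to [l]$ such that, for every $k$ and every $(a_1, \dots, a_{r_k}) \in R_k^{\mathcal{M}}$, the colours $\gamma(a_1), \dots, \gamma(a_{r_k})$ are not all equal. $\mathcal{M}$ is *$l$-colourable* if it has an $l$-colouring, and *uniquely $l$-colourable* if it is $l$-colourable and for all $l$-colourings $\gamma, \gamma'$ of $\mathcal{M}$ and all $a, b \in M$, $\gamma(a) = \gamma(b) \iff \gamma'(a) = \gamma'(b)$. A relation is *irreflexive* if each of its tuples has pairwise distinct entries, and *symmetric* if it is closed under permuting the entries of its tuples. For $I \subseteq [\rho]$ let $\mathbf{C}^I_n$ be the (finite) set of $l$-colourable $L_{rel}$-structures with universe $[n]$ in which $R_k$ is interpreted as an irreflexive and symmetric relation for every $k \in I$, and let $\mathbf{C}^I = \bigcup_{n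 \ge 1} \mathbf{C}^I_n$. We say that *almost all* $\mathcal{M} \in \mathbf{C}^I$ have a property if the proportion of $\mathcal{M} \in \mathbf{C}^I_n$ that have it tends to $1$ as $n \to \infty$. **Theorem.** For every $I \subseteq [\rho]$ the following hold. (i) There is an $L_{rel}$-formula $\xi(x,y)$ (without parameters) such that for almost all $\mathcal{M} \in \mathbf{C}^I$ the following holds: for every $l$-colouring $\gamma : M \to [l]$ of $\mathcal{M}$ and all $a, b \in M$, $\gamma(a) = \gamma(b)$ if and only if $\mathcal{M} \models \xi(a,b)$. (ii) Almost all $\mathcal{M} \in \mathbf{C}^I$ are uniquely $l$-colourable. (iii) $\mathbf{C}^I$ has a zero-one law: for every $L_{rel}$-sentence $\varphi$, either almost all $\mathcal{M} \in \mathbf{C}^I$ satisfy $\varphi$, or almost all $\mathcal{M} \in \mathbf{C}^I$ satisfy $\neg\varphi$. -/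

import Mathlib

open Filter Topology FirstOrder

namespace ColourableStructures

/-- The relational language with vocabulary `R_k`, `k : Fin ρ`, where `R_k` has arity `r k`,
and without constant or function symbols. -/
def relLanguage {ρ : ℕ} (r : Fin ρ → ℕ) : FirstOrder.Language.{0, 0} where
  Functions := fun _ => Empty
  Relations := fun m => {k : Fin ρ // r k = m}

variable {ρ : ℕ} {r : Fin ρ → ℕ} {A : Type}

/-- The interpretation of the relation symbol `R_k` in the structure `M` with universe `A`. -/
def interp (M : (relLanguage r).Structure A) (k : Fin ρ) (t : Fin (r k) → A) : Prop :=
  M.RelMap (⟨k, rfl⟩ : (relLanguage r).Relations (r k)) t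

/-- A tuple is monochromatic with respect to `γ` if all its entries have the same colour;
otherwise it is multichromatic. -/
def IsMultichromatic {l m : ℕ} (γ : A → Fin l) (t : Fin m → A) : Prop :=
  ¬ ∀ i j, γ (t i) = γ (t j)

/-- `γ` is an `l`-colouring of `M`: every tuple in every relation of `M` is multichromatic. -/
def IsColouring {l : ℕ} (M : (relLanguage r).Structure A) (γ : A → Fin l) : Prop :=
  ∀ (k : Fin ρ) (t : Fin (r k) → A), interp M k t → IsMultichromatic γ t

/-- `M` is `l`-colourable. -/
def IsColourable (l : ℕ) (M : (relLanguage r).Structure A) : Prop :=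
  ∃ γ : A → Fin l, IsColouring M γ

/-- `M` is uniquely `l`-colourable: it is `l`-colourable and all its `l`-colourings induce the
same partition of the universe. -/
def IsUniquelyColourable (l : ℕ) (M : (relLanguage r).Structure A) : Prop :=
  IsColourable l M ∧
    ∀ γ γ' : A → Fin l, IsColouring M γ → IsColouring M γ' →
      ∀ a b : A, γ a = γ b ↔ γ' a = γ' b

/-- An `m`-ary relation is irreflexive if its members have pairwise distinct entries. -/
def IsIrreflexiveRel {m : ℕ} (R : (Fin m → A) → Prop) : Prop :=
  ∀ t, R t → ∀ i j, i ≠ j → t i ≠ t j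

/-- An `m`-ary relation is symmetric if it is closed under permuting the entries of tuples. -/
def IsSymmetricRel {m : ℕ} (R : (Fin m → A) → Prop) : Prop :=
  ∀ t, R t → ∀ π : Equiv.Perm (Fin m), R (fun i => t (π i))

/-- The set of `l`-colourable structures with an `n`-element universe `Fin n` in which `R_k` is
irreflexive and symmetric for every `k ∈ I`. -/
def colourableClass (r : Fin ρ → ℕ) (l : ℕ) (I : Set (Fin ρ)) (n : ℕ) :
    Set ((relLanguage r).Structure (Fin n)) :=
  {M | IsColourable l M ∧
    ∀ k ∈ I, IsIrreflexiveRel (interp M k) ∧ IsSymmetricRel (interp M k)}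

/-- The proportion of members of `colourableClass r l I n` that have the property `P`. -/
noncomputable def proportion (r : Fin ρ → ℕ) (l : ℕ) (I : Set (Fin ρ))
    (P : ∀ n : ℕ, (relLanguage r).Structure (Fin n) → Prop) (n : ℕ) : ℝ :=
  ({M ∈ colourableClass r l I n | P n M}.ncard : ℝ) / ((colourableClass r l I n).ncard : ℝ)

/-- Almost all members of the class have the property `P`. -/
def AlmostAll (r : Fin ρ → ℕ) (l : ℕ) (I : Set (Fin ρ))
    (P : ∀ n : ℕ, (relLanguage r).Structure (Fin n) → Prop) : Prop :=
  Tendsto (proportion r l I P) atTop (𝓝 1)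

/-- `M` satisfies the first-order sentence `φ`. -/
def Satisfies (M : (relLanguage r).Structure A) (φ : (relLanguage r).Sentence) : Prop :=
  @FirstOrder.Language.Sentence.Realize (relLanguage r) A M φ

/-- `M` satisfies `ξ(a, b)`, where `ξ` is a first-order formula whose free variables are among
two variables (and without parameters). -/
def SatisfiesAt (M : (relLanguage r).Structure A) (ξ : (relLanguage r).Formula (Fin 2))
    (a b : A) : Prop :=
  @FirstOrder.Language.Formula.Realize (relLanguage r) A M (Fin 2) ξ ![a, b]

/-- The class has a zero-one law for the uniform probability measures. -/
def HasZeroOneLaw (r : Fin ρ → ℕ) (l : ℕ) (I : Set (Fin ρ)) : Prop :=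
  ∀ φ : (relLanguage r).Sentence,
    AlmostAll r l I (fun _ M => Satisfies M φ) ∨ AlmostAll r l I (fun _ M => Satisfies M φ.not)

/-- There are only finitely many structures on `Fin n`, so that cardinalities are genuine. -/
theorem finite_structure (r : Fin ρ → ℕ) (n : ℕ) :
    Finite ((relLanguage r).Structure (Fin n)) := by
  refine Finite.of_injective
    (fun (M : (relLanguage r).Structure (Fin n)) (k : Fin ρ) => interp M k) ?_
  intro M N h
  cases M with
  | mk f R =>
    cases N with
    | mk f' R' =>
      congr 1
      · funext m g
        exact g.elim
      · funext m s
        obtain ⟨k, rfl⟩ := s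
        exact congrFun h k

/-- The class is non-empty for every `n`: it contains the structure with empty relations. -/
theorem colourableClass_nonempty (r : Fin ρ → ℕ) {l : ℕ} (hl : 0 < l) (I : Set (Fin ρ))
    (n : ℕ) : (colourableClass r l I n).Nonempty := by
  refine ⟨⟨fun g => g.elim, fun _ _ => False⟩, ⟨fun _ => ⟨0, hl⟩, ?_⟩, ?_⟩
  · intro k t h
    exact h.elim
  · intro k _
    exact ⟨fun t h => h.elim, fun t h => h.elim⟩

end ColourableStructures

/-!
A structure is treated together with a colouring `γ`, and the uniform measure on the class is
compared with the uniform measures on the sets `colouredClass r I γ` of the admissible structures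
coloured by `γ`.

* If some class of `γ` has fewer than `n / (4 * l)` points, then moving many points from a large
  class into a small one gives a colouring of more structures, by a factor `2 ^ (c * n ^ 2)`
  (`exists_better_colouring`). The proof is an injection: old relations between the moved points
  and the small class are stored inside the large class, with room for quadratically many
  independent bits. Since there are only `l ^ n` colourings, almost no structure has a colouring
  with such a small class.
* If all classes of `γ` are that large, then a structure coloured by `γ` has the extension property
  with respect to `γ` outside a proportion that decays exponentially
  (`ncard_not_hasExtension_le`), because the candidates for a one-point extension depend on
  disjoint sets of tuples.
* A structure with the extension property contains, through any two points of the same colour,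
  complete multipartite blocks with `l` large parts, whose `l`-colourings are determined up to the
  names of the colours (`multipartite_colouring`). Thus the existence of such a block defines
  the relation of having the same colour in every colouring (`HasExtension.sameColour_iff`). In
  particular such a structure has at most `l ^ l` colourings, so that counting pairs of a structure
  and a colouring counts structures up to a constant factor, and almost all structures of the class
  have a colouring with the extension property (`almostAll_exists_hasExtension`).
* The extension property makes a back-and-forth argument between any two structures possible
  (`exists_extension_transfer`), which gives the zero-one law.
-/

namespace ColourableStructures

variable {ρ : ℕ} {r : Fin ρ → ℕ} {A B : Type} {l : ℕ}

/-! ### Structures as families of relations -/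

/-- The structure whose relations are the given ones. -/
@[reducible] def ofRel (R : ∀ k, (Fin (r k) → A) → Prop) : (relLanguage r).Structure A :=
  ⟨fun g => g.elim, fun s t => R s.1 (fun i => t (Fin.cast s.2 i))⟩

@[simp]
theorem interp_ofRel (R : ∀ k, (Fin (r k) → A) → Prop) (k : Fin ρ) (t : Fin (r k) → A) :
    interp (ofRel R) k t ↔ R k t := Iff.rfl

theorem interp_ext {M N : (relLanguage r).Structure A}
    (h : ∀ k t, interp M k t ↔ interp N k t) : M = N := by
  have h' : interp M = interp N := by
    funext k t
    exact propext (h k t)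
  cases M with
  | mk f R =>
    cases N with
    | mk f' R' =>
      congr 1
      · funext m g
        exact g.elim
      · funext m s
        obtain ⟨k, rfl⟩ := s
        exact congrFun h' k

/-- The structure pulled back along a map of universes. -/
@[reducible] def pullback (e : B → A) (M : (relLanguage r).Structure A) :
    (relLanguage r).Structure B :=
  ofRel fun k t => interp M k (fun i => e (t i))

/-- The relations with index in `I` are irreflexive and symmetric. -/
def IsAdmissible (I : Set (Fin ρ)) (M : (relLanguage r).Structure A) : Prop :=
  ∀ k ∈ I, IsIrreflexiveRel (interp M k) ∧ IsSymmetricRel (interp M k)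

theorem IsAdmissible.pullback {I : Set (Fin ρ)} {M : (relLanguage r).Structure A}
    (h : IsAdmissible I M) (e : B → A) : IsAdmissible I (pullback e M) := by
  intro k hk
  refine ⟨fun t ht i j hij htt => (h k hk).1 _ ht i j hij (congrArg e htt), fun t ht π => ?_⟩
  exact (h k hk).2 _ ht π

theorem IsColouring.pullback {M : (relLanguage r).Structure A} {γ : A → Fin l}
    (h : IsColouring M γ) (e : B → A) : IsColouring (pullback e M) (fun b => γ (e b)) :=
  fun k _ ht => h k _ ht

/-! ### Extension property, back-and-forth and transfer of formulas -/

/-- The new point `y` has colour `c` and stands to the points `ys` in the relations that `none`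
has to the points `some i` in the pattern `N`. -/
def Realises {s : ℕ} (M : (relLanguage r).Structure A) (γ : A → Fin l) (ys : Fin s → A)
    (c : Fin l) (N : (relLanguage r).Structure (Option (Fin s))) (y : A) : Prop :=
  y ∉ Set.range ys ∧ γ y = c ∧ ∀ k (t : Fin (r k) → Option (Fin s)), (∃ i, t i = none) →
    (interp M k (fun i => (t i).elim y ys) ↔ interp N k t)

/-- The extension property of a coloured structure: every one-point pattern over at most `K`
distinct points that is compatible with the colouring and with `I` is realised. -/
def HasExtension (I : Set (Fin ρ)) (K : ℕ) (M : (relLanguage r).Structure A) (γ : A → Fin l) :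
    Prop :=
  ∀ s ≤ K, ∀ ys : Fin s → A, Function.Injective ys → ∀ c : Fin l,
    ∀ N : (relLanguage r).Structure (Option (Fin s)),
      IsColouring N (fun o => o.elim c (fun i => γ (ys i))) → IsAdmissible I N →
        ∃ y, Realises M γ ys c N y

theorem HasExtension.mono {I : Set (Fin ρ)} {K K' : ℕ} (hK : K' ≤ K)
    {M : (relLanguage r).Structure A} {γ : A → Fin l} (h : HasExtension I K M γ) :
    HasExtension I K' M γ :=
  fun s hs => h s (hs.trans hK)

/-- The tuples `xs` and `ys` have the same quantifier-free type, colours included. -/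
structure IsPartialIso (M : (relLanguage r).Structure A) (γ : A → Fin l)
    (N : (relLanguage r).Structure B) (γ' : B → Fin l) {n : ℕ} (xs : Fin n → A)
    (ys : Fin n → B) : Prop where
  eq_iff : ∀ i j, xs i = xs j ↔ ys i = ys j
  colour : ∀ i, γ (xs i) = γ' (ys i)
  rel : ∀ k (t : Fin (r k) → Fin n), interp M k (fun i => xs (t i)) ↔
    interp N k (fun i => ys (t i))

section
variable {M : (relLanguage r).Structure A} {γ : A → Fin l}
  {N : (relLanguage r).Structure B} {γ' : B → Fin l} {n : ℕ} {xs : Fin n → A} {ys : Fin n → B}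

theorem IsPartialIso.symm (h : IsPartialIso M γ N γ' xs ys) : IsPartialIso N γ' M γ ys xs :=
  ⟨fun i j => (h.eq_iff i j).symm, fun i => (h.colour i).symm, fun k t => (h.rel k t).symm⟩

theorem IsPartialIso.comp (h : IsPartialIso M γ N γ' xs ys) {m : ℕ} (f : Fin m → Fin n) :
    IsPartialIso M γ N γ' (xs ∘ f) (ys ∘ f) :=
  ⟨fun i j => h.eq_iff (f i) (f j), fun i => h.colour (f i), fun k t => h.rel k (f ∘ t)⟩

/-- The extension property of `N` lets a partial isomorphism be extended to one more point
of `M`. -/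
theorem IsPartialIso.forth {I : Set (Fin ρ)} {K : ℕ} (h : IsPartialIso M γ N γ' xs ys)
    (hM : IsAdmissible I M) (hγ : IsColouring M γ) (hN : HasExtension I K N γ') (hn : n ≤ K)
    (x : A) : ∃ y, IsPartialIso M γ N γ' (Fin.snoc xs x : Fin (n + 1) → A)
      (Fin.snoc ys y : Fin (n + 1) → B) := by
  classical
  by_cases hx : ∃ i, xs i = x
  · obtain ⟨i, rfl⟩ := hx
    refine ⟨ys i, ?_⟩
    have := h.comp (Fin.snoc id i : Fin (n + 1) → Fin n)
    simpa only [Fin.comp_snoc, Function.comp_id] using this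
  push Not at hx
  -- a repetition-free subfamily of `ys` with the same range
  obtain ⟨s, hs, idx, hinj, hrange⟩ : ∃ s ≤ n, ∃ idx : Fin s → Fin n,
      Function.Injective (fun j => ys (idx j)) ∧ ∀ a, ∃ j, ys (idx j) = ys a := by
    let S := Finset.univ.image ys
    have hmem : ∀ z : S, ∃ a, ys a = z := fun z => by
      obtain ⟨a, -, ha⟩ := Finset.mem_image.1 z.2
      exact ⟨a, ha⟩
    choose g hg using hmem
    refine ⟨S.card, Finset.card_image_le.trans (by simp), fun j => g (S.equivFin.symm j), ?_, ?_⟩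
    · intro i j hij
      simp only [hg] at hij
      exact S.equivFin.symm.injective (Subtype.ext hij)
    · intro a
      refine ⟨S.equivFin ⟨ys a, Finset.mem_image_of_mem _ (Finset.mem_univ a)⟩, ?_⟩
      simp [hg]
  choose j hj using hrange
  let σ : Option (Fin s) → A := fun o => o.elim x (fun i => xs (idx i))
  obtain ⟨y, hy, hyc, hyr⟩ := hN s (hs.trans hn) (fun j => ys (idx j)) hinj (γ x) (pullback σ M)
    (by
      have := hγ.pullback σ
      convert this using 1
      funext o
      cases o with
      | none => rfl
      | some i => exact (h.colour _).symm) (hM.pullback σ)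
  have hy' : ∀ a, ys a ≠ y := fun a ha => hy ⟨j a, (hj a).trans ha⟩
  refine ⟨y, ⟨?_, ?_, ?_⟩⟩
  · intro a b
    induction a using Fin.lastCases with
    | last =>
      induction b using Fin.lastCases with
      | last => simp
      | cast b => simpa using iff_of_false (hx b).symm (hy' b).symm
    | cast a =>
      induction b using Fin.lastCases with
      | last => simpa using iff_of_false (hx a) (hy' a)
      | cast b => simpa using h.eq_iff a b
  · intro a
    induction a using Fin.lastCases with
    | last => simpa using hyc.symm
    | cast a => simpa using h.colour a
  · intro k t
    by_cases ht : ∃ i, t i = Fin.last n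
    · obtain ⟨i₀, hi₀⟩ := ht
      let f : Fin (n + 1) → Option (Fin s) := Fin.lastCases none (fun a => some (j a))
      have hf1 : ∀ a, (Fin.snoc xs x : Fin (n + 1) → A) a = σ (f a) := by
        intro a
        induction a using Fin.lastCases with
        | last => simp [f, σ]
        | cast a =>
          simp only [Fin.snoc_castSucc, f, σ, Fin.lastCases_castSucc, Option.elim_some]
          exact (h.eq_iff _ _).2 (hj a).symm
      have hf2 : ∀ a, (Fin.snoc ys y : Fin (n + 1) → B) a =
          (f a).elim y (fun j => ys (idx j)) := by
        intro a
        induction a using Fin.lastCases with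
        | last => simp [f]
        | cast a =>
          simp only [Fin.snoc_castSucc, f, Fin.lastCases_castSucc, Option.elim_some]
          exact (hj a).symm
      have := hyr k (fun i => f (t i)) ⟨i₀, by simp [hi₀, f]⟩
      simp only [hf1, hf2]
      exact this.symm
    · push Not at ht
      have : ∃ t' : Fin (r k) → Fin n, t = fun i => (t' i).castSucc :=
        ⟨fun i => (t i).castPred (ht i), by simp⟩
      obtain ⟨t', rfl⟩ := this
      simpa using h.rel k t'

/-- A finite coloured structure embeds into every coloured structure with a sufficiently strong
extension property, over any prescribed partial isomorphism. -/
theorem IsPartialIso.exists_embedding [Fintype A] {I : Set (Fin ρ)} {K : ℕ}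
    (h : IsPartialIso M γ N γ' xs ys) (hM : IsAdmissible I M) (hγ : IsColouring M γ)
    (hN : HasExtension I K N γ') (hn : n + Fintype.card A ≤ K) :
    ∃ e : A → B, (∀ i, e (xs i) = ys i) ∧ (∀ a, γ' (e a) = γ a) ∧
      ∀ k t, interp M k t ↔ interp N k (fun i => e (t i)) := by
  have key : ∀ L : List A, n + L.length ≤ K → ∃ (xs' : Fin (n + L.length) → A)
      (ys' : Fin (n + L.length) → B) (f : Fin n → Fin (n + L.length)),
      IsPartialIso M γ N γ' xs' ys' ∧ (∀ i, xs' (f i) = xs i) ∧ (∀ i, ys' (f i) = ys i) ∧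
        ∀ a ∈ L, ∃ i, xs' i = a := by
    intro L
    induction L with
    | nil => exact fun _ => ⟨xs, ys, id, h, fun _ => rfl, fun _ => rfl, by simp⟩
    | cons a L ih =>
      intro hL
      rw [List.length_cons] at hL
      obtain ⟨xs', ys', f, h', h1, h2, h3⟩ := ih (by omega)
      obtain ⟨y, hy⟩ := h'.forth hM hγ hN (by omega) a
      refine ⟨Fin.snoc xs' a, Fin.snoc ys' y, fun i => (f i).castSucc, hy, ?_, ?_, ?_⟩
      · intro i
        exact (Fin.snoc_castSucc (α := fun _ => A) a xs' (f i)).trans (h1 i)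
      · intro i
        exact (Fin.snoc_castSucc (α := fun _ => B) y ys' (f i)).trans (h2 i)
      · intro b hb
        rcases List.mem_cons.1 hb with rfl | hb
        · exact ⟨Fin.last _, Fin.snoc_last (α := fun _ => A) _ _⟩
        · obtain ⟨i, hi⟩ := h3 b hb
          exact ⟨i.castSucc, (Fin.snoc_castSucc (α := fun _ => A) a xs' i).trans hi⟩
  obtain ⟨xs', ys', f, h', h1, h2, h3⟩ := key Finset.univ.toList (by simpa using hn)
  choose g hg using fun a => h3 a (by simp)
  refine ⟨fun a => ys' (g a), fun i => ?_, fun a => ?_, fun k t => ?_⟩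
  · rw [← h2 i]
    exact (h'.eq_iff _ _).1 ((hg _).trans (h1 i).symm)
  · rw [← h'.colour, hg]
  · simpa only [hg] using h'.rel k (fun i => g (t i))

end

/-- Coloured structures with a sufficiently strong extension property satisfy the same formulas
at tuples of the same coloured quantifier-free type. -/
theorem exists_extension_transfer (l : ℕ) (I : Set (Fin ρ)) {n : ℕ}
    (φ : (relLanguage r).BoundedFormula Empty n) : ∃ K : ℕ, ∀ (A B : Type)
      (M : (relLanguage r).Structure A) (N : (relLanguage r).Structure B) (γ : A → Fin l)
      (γ' : B → Fin l), IsAdmissible I M → IsAdmissible I N → IsColouring M γ →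
      IsColouring N γ' → HasExtension I K M γ → HasExtension I K N γ' →
      ∀ (v : Empty → A) (w : Empty → B) (xs : Fin n → A) (ys : Fin n → B),
        IsPartialIso M γ N γ' xs ys →
          (@Language.BoundedFormula.Realize _ A M Empty n φ v xs ↔
            @Language.BoundedFormula.Realize _ B N Empty n φ w ys) := by
  have term : ∀ {m : ℕ} (u : (relLanguage r).Term (Empty ⊕ Fin m)), ∃ i,
      u = Language.Term.var (Sum.inr i) := by
    intro m u
    cases u with
    | var x =>
      rcases x with x | x
      · exact x.elim
      · exact ⟨x, rfl⟩
    | func f _ => exact f.elim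
  induction φ with
  | falsum => exact ⟨0, fun _ _ _ _ _ _ _ _ _ _ _ _ _ _ _ _ _ => Iff.rfl⟩
  | equal u₁ u₂ =>
    obtain ⟨i, rfl⟩ := term u₁
    obtain ⟨j, rfl⟩ := term u₂
    exact ⟨0, fun _ _ _ _ _ _ _ _ _ _ _ _ _ _ _ _ h => h.eq_iff i j⟩
  | rel R ts =>
    obtain ⟨k, rfl⟩ := R
    choose i hi using fun j => term (ts j)
    obtain rfl : ts = fun j => Language.Term.var (Sum.inr (i j)) := funext hi
    exact ⟨0, fun _ _ _ _ _ _ _ _ _ _ _ _ _ _ _ _ h => h.rel k i⟩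
  | imp φ ψ ih₁ ih₂ =>
    obtain ⟨K₁, h₁⟩ := ih₁
    obtain ⟨K₂, h₂⟩ := ih₂
    refine ⟨max K₁ K₂, fun A B M N γ γ' a b c d e f v w xs ys h => ?_⟩
    exact imp_congr
      (h₁ A B M N γ γ' a b c d (e.mono (le_max_left _ _)) (f.mono (le_max_left _ _)) v w xs ys h)
      (h₂ A B M N γ γ' a b c d (e.mono (le_max_right _ _)) (f.mono (le_max_right _ _)) v w xs ys h)
  | @all m φ ih =>
    obtain ⟨K, hK⟩ := ih
    refine ⟨max K m, fun A B M N γ γ' a b c d e f v w xs ys h => ?_⟩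
    have hK' := hK A B M N γ γ' a b c d (e.mono (le_max_left _ _)) (f.mono (le_max_left _ _)) v w
    constructor
    · intro H y
      obtain ⟨x, hx⟩ := h.symm.forth b d e (le_max_right _ _) y
      exact (hK' _ _ hx.symm).1 (H x)
    · intro H x
      obtain ⟨y, hy⟩ := h.forth a c f (le_max_right _ _) x
      exact (hK' _ _ hy).2 (H y)

/-! ### Complete multipartite blocks and the definability of the colour classes -/

/-- If every part has more than `l * (q - 1)` vertices, then the complete multipartite `q`-uniform
hypergraph with `l` parts has no `l`-colourings but those whose classes are the parts: each part
has `q` vertices of one colour, no vertex outside that part can share this colour, and so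
different parts are assigned different colours. -/
theorem multipartite_colouring {q m : ℕ} (hq : 2 ≤ q) (hm : l * (q - 1) < m)
    {δ : Fin l × Fin m → Fin l}
    (h : ∀ t : Fin q → Fin l × Fin m, Function.Injective t → IsMultichromatic Prod.fst t →
      IsMultichromatic δ t) (x y : Fin l × Fin m) : δ x = δ y ↔ x.1 = y.1 := by
  classical
  have hfib : ∀ i : Fin l, ∃ c : Fin l, q - 1 <
      (Finset.univ.filter fun j : Fin m => δ (i, j) = c).card := by
    intro i
    obtain ⟨c, -, hc⟩ := Finset.exists_lt_card_fiber_of_mul_lt_card_of_maps_to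
      (s := (Finset.univ : Finset (Fin m))) (t := (Finset.univ : Finset (Fin l)))
      (f := fun j => δ (i, j)) (n := q - 1) (fun _ _ => Finset.mem_univ _) (by simpa using hm)
    exact ⟨c, hc⟩
  choose g hg using hfib
  have hpart : ∀ z i, δ z = g i → z.1 = i := by
    intro z i hz
    by_contra hne
    obtain ⟨F, hF, hFc⟩ := Finset.exists_subset_card_eq (hg i).le
    let F' : Finset (Fin l × Fin m) := F.map ⟨fun j => (i, j), fun a b hab => by simpa using hab⟩
    have hzF : z ∉ F' := by
      intro hz'
      obtain ⟨j, -, rfl⟩ := Finset.mem_map.1 hz'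
      exact hne rfl
    have hcard : (insert z F').card = q := by
      rw [Finset.card_insert_of_notMem hzF, Finset.card_map, hFc]
      omega
    let e := (Finset.equivFinOfCardEq hcard).symm
    have hδ : ∀ w ∈ insert z F', δ w = g i := by
      intro w hw
      rcases Finset.mem_insert.1 hw with rfl | hw
      · exact hz
      · obtain ⟨j, hj, rfl⟩ := Finset.mem_map.1 hw
        exact (Finset.mem_filter.1 (hF hj)).2
    refine h (fun a => (e a : Fin l × Fin m)) (Subtype.val_injective.comp e.injective) ?_ ?_
    · intro hall
      obtain ⟨j, hj⟩ : F.Nonempty := Finset.card_pos.1 (by omega)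
      have h1 := hall (e.symm ⟨z, Finset.mem_insert_self _ _⟩)
        (e.symm ⟨(i, j), Finset.mem_insert_of_mem (Finset.mem_map.2 ⟨j, hj, rfl⟩)⟩)
      simp only [Equiv.apply_symm_apply] at h1
      exact hne h1
    · intro a b
      rw [hδ _ (e a).2, hδ _ (e b).2]
  have hginj : Function.Injective g := by
    intro i i' hii
    obtain ⟨j, hj⟩ : (Finset.univ.filter fun j : Fin m => δ (i', j) = g i').Nonempty :=
      Finset.card_pos.1 (by have := hg i'; omega)
    exact (hpart (i', j) i ((Finset.mem_filter.1 hj).2.trans hii.symm)).symm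
  have hval : ∀ z, δ z = g z.1 := by
    intro z
    obtain ⟨i, hi⟩ := (Finite.injective_iff_surjective.1 hginj) (δ z)
    rw [hpart z i hi.symm, hi]
  rw [hval, hval, hginj.eq_iff]

/-- The structure on `Fin l × Fin m` in which every relation consists of all repetition-free
tuples that meet at least two of the `l` parts. -/
@[reducible] def multipartite (r : Fin ρ → ℕ) (l m : ℕ) :
    (relLanguage r).Structure (Fin l × Fin m) :=
  ofRel fun _ t => Function.Injective t ∧ IsMultichromatic Prod.fst t

theorem isAdmissible_multipartite (I : Set (Fin ρ)) (m : ℕ) :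
    IsAdmissible I (multipartite r l m) := by
  intro k _
  refine ⟨fun t ht i j hij h => hij (ht.1 h), fun t ht π => ⟨ht.1.comp π.injective, fun h => ?_⟩⟩
  exact ht.2 fun i j => by simpa using h (π.symm i) (π.symm j)

theorem isColouring_multipartite (m : ℕ) (σ : Equiv.Perm (Fin l)) :
    IsColouring (multipartite r l m) (fun x => σ x.1) :=
  fun _ _ ht h => ht.2 fun i j => σ.injective (h i j)

/-- The formula saying that the two variables are equal or are two points, in the positions `p` and
`p'`, of a copy of the complete multipartite hypergraph inside the relation `R_k`. -/
noncomputable def sameColour (r : Fin ρ → ℕ) (k : Fin ρ) (l m : ℕ) (p p' : Fin l × Fin m) :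
    (relLanguage r).Formula (Fin 2) :=
  (Language.Term.equal (Language.Term.var 0) (Language.Term.var 1)) ⊔
  Language.Formula.iExs (Fin l × Fin m)
    ((Language.Term.equal (Language.Term.var (Sum.inl 0)) (Language.Term.var (Sum.inr p))) ⊓
      ((Language.Term.equal (Language.Term.var (Sum.inl 1)) (Language.Term.var (Sum.inr p'))) ⊓
      Language.Formula.iInf fun t : {t : Fin (r k) → Fin l × Fin m //
          Function.Injective t ∧ IsMultichromatic Prod.fst t} =>
        Language.Relations.formula (⟨k, rfl⟩ : (relLanguage r).Relations (r k))
          (fun i => Language.Term.var (Sum.inr (t.1 i)))))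

theorem satisfiesAt_sameColour (M : (relLanguage r).Structure A) (k : Fin ρ) (l m : ℕ)
    (p p' : Fin l × Fin m) (a b : A) :
    SatisfiesAt M (sameColour r k l m p p') a b ↔ a = b ∨ ∃ e : Fin l × Fin m → A,
      a = e p ∧ b = e p' ∧ ∀ t : Fin (r k) → Fin l × Fin m, Function.Injective t →
        IsMultichromatic Prod.fst t → interp M k (fun i => e (t i)) := by
  let _ := M
  simp only [SatisfiesAt, sameColour, Language.Formula.realize_sup, Language.Formula.realize_equal,
    Language.Formula.realize_iExs, Language.Formula.realize_inf, Language.Formula.realize_iInf,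
    Language.Term.realize_var, Sum.elim_inl, Sum.elim_inr,
    Subtype.forall, and_imp]
  rfl

/-- In a coloured structure with a sufficiently strong extension property the formula
`sameColour` defines the relation of having the same colour, for every colouring. -/
theorem HasExtension.sameColour_iff {I : Set (Fin ρ)} {M : (relLanguage r).Structure A}
    {γ : A → Fin l} {m : ℕ} {k : Fin ρ} (hk : 2 ≤ r k) (hm : l * (r k - 1) < m)
    (hγ : IsColouring M γ) (hM : HasExtension I (2 + l * m) M γ) {i₀ : Fin l} {j₀ j₁ : Fin m}
    (hj : j₀ ≠ j₁) {γ' : A → Fin l} (hγ' : IsColouring M γ') (a b : A) :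
    γ' a = γ' b ↔ SatisfiesAt M (sameColour r k l m (i₀, j₀) (i₀, j₁)) a b := by
  classical
  rw [satisfiesAt_sameColour]
  have hblock : ∀ e : Fin l × Fin m → A, (∀ t : Fin (r k) → Fin l × Fin m,
      Function.Injective t → IsMultichromatic Prod.fst t → interp M k (fun i => e (t i))) →
      ∀ x y, γ' (e x) = γ' (e y) ↔ x.1 = y.1 := fun e he =>
    multipartite_colouring hk hm fun t ht ht' => hγ' k _ (he t ht ht')
  -- points of the part `i₀` and equally many points of one `γ`-class form a partial isomorphism,
  -- as neither side contains a related tuple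
  have hmono : ∀ {n : ℕ} (xs : Fin n → Fin l × Fin m) (ys : Fin n → A) (x : A),
      (∀ i, (xs i).1 = i₀) → (∀ i, γ (ys i) = γ x) → (∀ i j, xs i = xs j ↔ ys i = ys j) →
      IsPartialIso (multipartite r l m) (fun z => Equiv.swap i₀ (γ x) z.1) M γ xs ys := by
    intro n xs ys x hx hy hxy
    refine ⟨hxy, fun i => by rw [hx, hy, Equiv.swap_apply_left], fun k' t => ?_⟩
    refine iff_of_false (fun ht => ht.2 fun i j => by rw [hx, hx]) (fun ht => ?_)
    exact hγ k' _ ht fun i j => by rw [hy, hy]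
  have hcard : Fintype.card (Fin l × Fin m) = l * m := by simp
  have hdef : ∀ a b, γ a = γ b → a = b ∨ ∃ e : Fin l × Fin m → A,
      a = e (i₀, j₀) ∧ b = e (i₀, j₁) ∧ ∀ t : Fin (r k) → Fin l × Fin m, Function.Injective t →
        IsMultichromatic Prod.fst t → interp M k (fun i => e (t i)) := by
    intro a b hab
    refine or_iff_not_imp_left.2 fun hne => ?_
    obtain ⟨e, he1, -, he3⟩ := (hmono ![(i₀, j₀), (i₀, j₁)] ![a, b] a
      (by simp [Fin.forall_fin_two]) (by simp [Fin.forall_fin_two, hab])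
      (by simp [Fin.forall_fin_two, hne, Ne.symm hne, hj, Ne.symm hj])).exists_embedding
      (isAdmissible_multipartite I m) (isColouring_multipartite m _) hM (by rw [hcard])
    exact ⟨e, (he1 0).symm, (he1 1).symm, fun t ht ht' => (he3 k t).1 ⟨ht, ht'⟩⟩
  have hsound : ∀ a b, (a = b ∨ ∃ e : Fin l × Fin m → A,
      a = e (i₀, j₀) ∧ b = e (i₀, j₁) ∧ ∀ t : Fin (r k) → Fin l × Fin m, Function.Injective t →
        IsMultichromatic Prod.fst t → interp M k (fun i => e (t i))) → γ' a = γ' b := by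
    rintro a b (rfl | ⟨e, rfl, rfl, he⟩)
    · rfl
    · exact (hblock e he _ _).2 rfl
  refine ⟨fun hab => hdef a b ?_, hsound a b⟩
  -- a block through `a` meets the `γ`-class of `b` in a vertex `d`, and `γ' d = γ' b`
  by_contra hne
  obtain ⟨e, he1, he2, he3⟩ := (hmono ![(i₀, j₀)] ![a] a
    (by simp) (by simp) (by simp)).exists_embedding
    (isAdmissible_multipartite I m) (isColouring_multipartite m _) hM (by rw [hcard]; omega)
  let d := (Equiv.swap i₀ (γ a) (γ b), j₀)
  have hd : γ (e d) = γ b := by rw [he2]; simp [d]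
  have h1 : γ' (e d) = γ' b := hsound _ _ (hdef _ _ hd)
  have h2 : e (i₀, j₀) = a := he1 0
  have h3 := (hblock e (fun t ht ht' => (he3 k t).1 ⟨ht, ht'⟩) (i₀, j₀) d).1
    (by rw [h2, h1, hab])
  have h4 := congrArg (Equiv.swap i₀ (γ a)) h3
  simp only [d, Equiv.swap_apply_left, Equiv.swap_apply_self] at h4
  exact hne h4

/-! ### Failure of the extension property is rare for a fixed colouring -/

instance finite_structure_of_finite [Finite A] : Finite ((relLanguage r).Structure A) :=
  Finite.of_injective (fun (M : (relLanguage r).Structure A) (k : Fin ρ) => interp M k)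
    fun _ _ h => interp_ext fun k t => iff_of_eq (congrFun (congrFun h k) t)

/-- The admissible structures for which `γ` is a colouring. -/
def colouredClass (r : Fin ρ → ℕ) (I : Set (Fin ρ)) (γ : A → Fin l) :
    Set ((relLanguage r).Structure A) :=
  {M | IsColouring M γ ∧ IsAdmissible I M}

open Classical in
/-- Redefine the structure `M` by the pattern `N` on the tuples from the range of `e` that contain
the point `e none`. -/
@[reducible] def overwrite {s : ℕ} (e : Option (Fin s) → A)
    (N : (relLanguage r).Structure (Option (Fin s)))
    (M : (relLanguage r).Structure A) : (relLanguage r).Structure A :=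
  ofRel fun k t => if (∃ i, t i = e none) ∧ ∀ i, t i ∈ Set.range e then
    ∃ t', (fun i => e (t' i)) = t ∧ interp N k t' else interp M k t

section
variable {s : ℕ} {e : Option (Fin s) → A} {N : (relLanguage r).Structure (Option (Fin s))}
  {M : (relLanguage r).Structure A} {γ : A → Fin l} {I : Set (Fin ρ)}

theorem interp_overwrite_of_not {k : Fin ρ} {t : Fin (r k) → A}
    (h : ¬ ((∃ i, t i = e none) ∧ ∀ i, t i ∈ Set.range e)) :
    interp (overwrite e N M) k t ↔ interp M k t := by
  rw [overwrite, interp_ofRel, if_neg h]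

theorem interp_overwrite_comp (he : Function.Injective e) {k : Fin ρ}
    {t : Fin (r k) → Option (Fin s)} (ht : ∃ i, t i = none) :
    interp (overwrite e N M) k (fun i => e (t i)) ↔ interp N k t := by
  rw [overwrite, interp_ofRel, if_pos ⟨ht.imp fun i hi => congrArg e hi, fun i => ⟨t i, rfl⟩⟩]
  refine ⟨fun ⟨t', h, h'⟩ => ?_, fun h => ⟨t, rfl, h⟩⟩
  obtain rfl : t' = t := funext fun i => he (congrFun h i)
  exact h'

theorem overwrite_mem_colouredClass (he : Function.Injective e)
    (hN : N ∈ colouredClass r I (fun o => γ (e o))) (hM : M ∈ colouredClass r I γ) :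
    overwrite e N M ∈ colouredClass r I γ := by
  have hcases : ∀ k (t : Fin (r k) → A),
      (∃ t' : Fin (r k) → Option (Fin s), t = (fun i => e (t' i)) ∧ ∃ i, t' i = none) ∨
        ¬ ((∃ i, t i = e none) ∧ ∀ i, t i ∈ Set.range e) := by
    intro k t
    refine or_iff_not_imp_right.2 fun h => ?_
    rw [not_not] at h
    obtain ⟨⟨i, hi⟩, h⟩ := h
    choose t' ht' using h
    exact ⟨t', funext fun i => (ht' i).symm, i, he ((ht' i).trans hi)⟩
  refine ⟨fun k t ht => ?_, fun k hk => ⟨fun t ht i j hij => ?_, fun t ht π => ?_⟩⟩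
  · rcases hcases k t with ⟨t, rfl, ht'⟩ | h
    · exact hN.1 k t ((interp_overwrite_comp he ht').1 ht)
    · exact hM.1 k t ((interp_overwrite_of_not h).1 ht)
  · rcases hcases k t with ⟨t, rfl, ht'⟩ | h
    · exact he.ne ((hN.2 k hk).1 t ((interp_overwrite_comp he ht').1 ht) i j hij)
    · exact (hM.2 k hk).1 t ((interp_overwrite_of_not h).1 ht) i j hij
  · rcases hcases k t with ⟨t, rfl, ht'⟩ | h
    · have := (hN.2 k hk).2 t ((interp_overwrite_comp he ht').1 ht) π
      refine (interp_overwrite_comp he (t := fun i => t (π i)) ?_).2 this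
      obtain ⟨i, hi⟩ := ht'
      exact ⟨π.symm i, by simpa using hi⟩
    · have := (hM.2 k hk).2 t ((interp_overwrite_of_not h).1 ht) π
      refine (interp_overwrite_of_not fun h' => h ⟨?_, fun i => ?_⟩).2 this
      · exact ⟨π h'.1.choose, h'.1.choose_spec⟩
      · simpa using h'.2 (π.symm i)

/-- The tuples whose values are lost in `overwrite e N M` are kept by `pullback e M`, whose
number of possible values does not depend on the size of `A`. -/
theorem overwrite_pullback_injective {M₁ M₂ : (relLanguage r).Structure A}
    (h₁ : overwrite e N M₁ = overwrite e N M₂) (h₂ : pullback e M₁ = pullback e M₂) : M₁ = M₂ := by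
  refine interp_ext fun k t => ?_
  by_cases h : (∃ i, t i = e none) ∧ ∀ i, t i ∈ Set.range e
  · choose t' ht' using h.2
    obtain rfl : (fun i => e (t' i)) = t := funext ht'
    change interp (pullback e M₁) k t' ↔ interp (pullback e M₂) k t'
    rw [h₂]
  · rw [← interp_overwrite_of_not (N := N) h, h₁, interp_overwrite_of_not h]

end

section
variable [Finite A] {s : ℕ} {γ : A → Fin l} {I : Set (Fin ρ)}
  {ys : Fin s → A} {c : Fin l} {N : (relLanguage r).Structure (Option (Fin s))}

/-- Different candidate points are tested on disjoint sets of tuples, so that each further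
candidate reduces the number of structures in which all candidates fail by a constant factor. -/
theorem ncard_forall_not_realises_le (hys : Function.Injective ys)
    (hN : N ∈ colouredClass r I (fun o : Option (Fin s) => o.elim c (fun i => γ (ys i))))
    (Y : Finset A) (hY : ∀ y ∈ Y, y ∉ Set.range ys ∧ γ y = c) :
    ({M ∈ colouredClass r I γ | ∀ y ∈ Y, ¬ Realises M γ ys c N y}.ncard : ℝ) ≤
      (1 - 1 / ((Nat.card ((relLanguage r).Structure (Option (Fin s))) : ℝ) + 1)) ^ Y.card *
        (colouredClass r I γ).ncard := by
  classical
  set Q := Nat.card ((relLanguage r).Structure (Option (Fin s))) with hQ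
  induction Y using Finset.induction_on with
  | empty => simp
  | insert z Y hz ih =>
    specialize ih fun y hy => hY y (Finset.mem_insert_of_mem hy)
    obtain ⟨hz1, hz2⟩ := hY z (Finset.mem_insert_self _ _)
    set F := {M ∈ colouredClass r I γ | ∀ y ∈ Y, ¬ Realises M γ ys c N y} with hF
    set e : Option (Fin s) → A := fun o => o.elim z ys with he
    have hcol : (fun o => γ (e o)) = fun o : Option (Fin s) => o.elim c (fun i => γ (ys i)) := by
      funext o
      cases o with
      | none => exact hz2
      | some i => rfl
    have heinj : Function.Injective e := by
      intro o o' h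
      cases o with
      | none =>
        cases o' with
        | none => rfl
        | some i => exact (hz1 ⟨i, h.symm⟩).elim
      | some i =>
        cases o' with
        | none => exact (hz1 ⟨i, h⟩).elim
        | some j => exact congrArg some (hys h)
    have hsplit : {M ∈ colouredClass r I γ | ∀ y ∈ insert z Y, ¬ Realises M γ ys c N y} =
        F \ {M | Realises M γ ys c N z} := by
      ext M
      simp only [hF, Set.mem_ofPred_eq, Finset.forall_mem_insert, Set.mem_sdiff]
      tauto
    have hcard : (F ∩ {M | Realises M γ ys c N z}).ncard +
        (F \ {M | Realises M γ ys c N z}).ncard = F.ncard :=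
      Set.ncard_inter_add_ncard_sdiff_eq_ncard F _ (Set.toFinite _)
    have hfib : F.ncard ≤ (F ∩ {M | Realises M γ ys c N z}).ncard * Q := by
      rw [hQ, ← Set.ncard_univ, ← Set.ncard_prod]
      refine Set.ncard_le_ncard_of_injOn (fun M => (overwrite e N M, pullback e M)) ?_ ?_
      · rintro M ⟨hM, hMY⟩
        refine ⟨⟨⟨overwrite_mem_colouredClass heinj (hcol ▸ hN) hM, ?_⟩, ?_⟩, trivial⟩
        · rintro y hy ⟨h1, h2, h3⟩
          refine hMY y hy ⟨h1, h2, fun k t ht => ?_⟩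
          rw [← h3 k t ht]
          refine (interp_overwrite_of_not fun h => ?_).symm
          obtain ⟨i, hi⟩ := ht
          obtain ⟨o, ho⟩ := h.2 i
          rw [hi] at ho
          cases o with
          | none => exact hz ((show z = y from ho) ▸ hy)
          | some j => exact h1 ⟨j, ho⟩
        · exact ⟨hz1, hz2, fun k t ht => interp_overwrite_comp heinj ht⟩
      · intro M₁ _ M₂ _ h
        exact overwrite_pullback_injective (Prod.ext_iff.1 h).1 (Prod.ext_iff.1 h).2
    rw [hsplit, Finset.card_insert_of_notMem hz, pow_succ]
    have h1 : ((F ∩ {M | Realises M γ ys c N z}).ncard : ℝ) +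
        (F \ {M | Realises M γ ys c N z}).ncard = F.ncard := by exact_mod_cast hcard
    have h2 : (F.ncard : ℝ) ≤ (F ∩ {M | Realises M γ ys c N z}).ncard * Q := by
      exact_mod_cast hfib
    have hQ0 : (0 : ℝ) < (Q : ℝ) + 1 := by positivity
    have hq : (0 : ℝ) ≤ 1 - 1 / ((Q : ℝ) + 1) := by
      rw [sub_nonneg, div_le_one hQ0]
      linarith [Nat.cast_nonneg (α := ℝ) Q]
    have h3 : (F.ncard : ℝ) / (Q + 1) ≤ (F ∩ {M | Realises M γ ys c N z}).ncard := by
      rw [div_le_iff₀ hQ0]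
      nlinarith [Nat.cast_nonneg (α := ℝ) (F ∩ {M | Realises M γ ys c N z}).ncard]
    calc ((F \ {M | Realises M γ ys c N z}).ncard : ℝ)
        ≤ (1 - 1 / ((Q : ℝ) + 1)) * F.ncard := by
          rw [sub_mul, one_mul, one_div, ← div_eq_inv_mul]
          linarith
      _ ≤ (1 - 1 / ((Q : ℝ) + 1)) * ((1 - 1 / ((Q : ℝ) + 1)) ^ Y.card *
          (colouredClass r I γ).ncard) := mul_le_mul_of_nonneg_left ih hq
      _ = _ := by ring

end

/-- The number of one-point patterns over `s` points. -/
noncomputable def patternCount (r : Fin ρ → ℕ) (s : ℕ) : ℝ :=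
  Nat.card ((relLanguage r).Structure (Option (Fin s)))

/-- The factor by which each further candidate point reduces the proportion of structures in
which a pattern over `s` points is not realised. -/
noncomputable def failRate (r : Fin ρ → ℕ) (s : ℕ) : ℝ :=
  1 - 1 / (patternCount r s + 1)

theorem failRate_pos (r : Fin ρ → ℕ) (s : ℕ) : 0 < failRate r s := by
  have : (0 : ℝ) < patternCount r s := by
    have : Nonempty ((relLanguage r).Structure (Option (Fin s))) := ⟨ofRel fun _ _ => False⟩
    exact Nat.cast_pos.2 Nat.card_pos
  rw [failRate, sub_pos, div_lt_one (by linarith)]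
  linarith

theorem failRate_lt_one (r : Fin ρ → ℕ) (s : ℕ) : failRate r s < 1 := by
  have : (0 : ℝ) ≤ patternCount r s := Nat.cast_nonneg _
  rw [failRate, sub_lt_self_iff]
  positivity

/-- A bound for the proportion of structures coloured by `γ : Fin n → Fin l` without the extension
property, if all colour classes of `γ` have at least `u` elements. -/
noncomputable def failBound (r : Fin ρ → ℕ) (l K n u : ℕ) : ℝ :=
  ∑ s ∈ Finset.range (K + 1), (n : ℝ) ^ s * l * patternCount r s * failRate r s ^ (u - s)

theorem ncard_iUnion_le_mul {ι α : Type*} [Fintype ι] [Finite α] (S : ι → Set α) (b : ℝ)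
    (h : ∀ i, ((S i).ncard : ℝ) ≤ b) : ((⋃ i, S i).ncard : ℝ) ≤ Fintype.card ι * b := by
  calc ((⋃ i, S i).ncard : ℝ) ≤ ∑ i, ((S i).ncard : ℝ) := by
        exact_mod_cast Set.ncard_iUnion_le_of_fintype S
    _ ≤ ∑ _i : ι, b := Finset.sum_le_sum fun i _ => h i
    _ = _ := by simp

theorem ncard_not_hasExtension_le (I : Set (Fin ρ)) (K n u : ℕ) (γ : Fin n → Fin l)
    (hγ : ∀ c, u ≤ (Finset.univ.filter fun y => γ y = c).card) :
    ({M ∈ colouredClass r I γ | ¬ HasExtension I K M γ}.ncard : ℝ) ≤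
      failBound r l K n u * (colouredClass r I γ).ncard := by
  classical
  have hpat : ∀ s (p : (Fin s → Fin n) × Fin l × (relLanguage r).Structure (Option (Fin s))),
      ({M ∈ colouredClass r I γ | Function.Injective p.1 ∧
        p.2.2 ∈ colouredClass r I (fun o : Option (Fin s) => o.elim p.2.1 (fun i => γ (p.1 i))) ∧
        ∀ y, ¬ Realises M γ p.1 p.2.1 p.2.2 y}.ncard : ℝ) ≤
      failRate r s ^ (u - s) * (colouredClass r I γ).ncard := by
    rintro s ⟨ys, c, N⟩
    by_cases h : Function.Injective ys ∧
        N ∈ colouredClass r I (fun o : Option (Fin s) => o.elim c (fun i => γ (ys i)))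
    · let Y := (Finset.univ.filter fun y => γ y = c) \ Finset.univ.image ys
      have hY : ∀ y ∈ Y, y ∉ Set.range ys ∧ γ y = c := by
        intro y hy
        simp only [Y, Finset.mem_sdiff, Finset.mem_filter, Finset.mem_univ, true_and,
          Finset.mem_image] at hy
        exact ⟨hy.2, hy.1⟩
      have hYc : u - s ≤ Y.card := by
        have h1 := Finset.le_card_sdiff (Finset.univ.image ys) (Finset.univ.filter fun y => γ y = c)
        have h2 : (Finset.univ.image ys).card ≤ s := Finset.card_image_le.trans (by simp)
        have h3 := hγ c
        change _ ≤ Y.card at h1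
        omega
      calc _ ≤ ({M ∈ colouredClass r I γ | ∀ y ∈ Y, ¬ Realises M γ ys c N y}.ncard : ℝ) := by
            refine Nat.cast_le.2 (Set.ncard_le_ncard ?_ (Set.toFinite _))
            exact fun M hM => ⟨hM.1, fun y _ => hM.2.2.2 y⟩
        _ ≤ failRate r s ^ Y.card * (colouredClass r I γ).ncard :=
            ncard_forall_not_realises_le h.1 h.2 Y hY
        _ ≤ _ := by
            gcongr ?_ * _
            exact pow_le_pow_of_le_one (failRate_pos r s).le (failRate_lt_one r s).le hYc
    · have : {M ∈ colouredClass r I γ | Function.Injective ys ∧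
        N ∈ colouredClass r I (fun o : Option (Fin s) => o.elim c (fun i => γ (ys i))) ∧
        ∀ y, ¬ Realises M γ ys c N y} = ∅ := by
        ext M
        simp only [Set.mem_ofPred_eq, Set.mem_empty_iff_false, iff_false]
        tauto
      rw [this]
      have := (failRate_pos r s).le
      simp only [Set.ncard_empty, Nat.cast_zero]
      positivity
  have hsub : {M ∈ colouredClass r I γ | ¬ HasExtension I K M γ} ⊆
      ⋃ s ∈ Finset.range (K + 1),
        ⋃ p : (Fin s → Fin n) × Fin l × (relLanguage r).Structure (Option (Fin s)),
        {M ∈ colouredClass r I γ | Function.Injective p.1 ∧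
          p.2.2 ∈ colouredClass r I (fun o : Option (Fin s) => o.elim p.2.1 (fun i => γ (p.1 i))) ∧
          ∀ y, ¬ Realises M γ p.1 p.2.1 p.2.2 y} := by
    rintro M ⟨hM, hE⟩
    simp only [HasExtension] at hE
    push Not at hE
    obtain ⟨s, hs, ys, hys, c, N, hN1, hN2, hN3⟩ := hE
    simp only [Set.mem_iUnion]
    exact ⟨s, Finset.mem_range.2 (by omega), (ys, c, N), hM, hys, ⟨hN1, hN2⟩, hN3⟩
  calc _ ≤ ((⋃ s ∈ Finset.range (K + 1),
        ⋃ p : (Fin s → Fin n) × Fin l × (relLanguage r).Structure (Option (Fin s)),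
        {M ∈ colouredClass r I γ | Function.Injective p.1 ∧
          p.2.2 ∈ colouredClass r I (fun o : Option (Fin s) => o.elim p.2.1 (fun i => γ (p.1 i))) ∧
          ∀ y, ¬ Realises M γ p.1 p.2.1 p.2.2 y}).ncard : ℝ) :=
        Nat.cast_le.2 (Set.ncard_le_ncard hsub (Set.toFinite _))
    _ ≤ ∑ s ∈ Finset.range (K + 1), ((
        ⋃ p : (Fin s → Fin n) × Fin l × (relLanguage r).Structure (Option (Fin s)),
        {M ∈ colouredClass r I γ | Function.Injective p.1 ∧
          p.2.2 ∈ colouredClass r I (fun o : Option (Fin s) => o.elim p.2.1 (fun i => γ (p.1 i))) ∧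
          ∀ y, ¬ Realises M γ p.1 p.2.1 p.2.2 y}).ncard : ℝ) := by
        exact_mod_cast Finset.set_ncard_biUnion_le _ _
    _ ≤ ∑ s ∈ Finset.range (K + 1), (n : ℝ) ^ s * l * patternCount r s *
          failRate r s ^ (u - s) * (colouredClass r I γ).ncard := by
        refine Finset.sum_le_sum fun s _ => ?_
        have : Fintype ((relLanguage r).Structure (Option (Fin s))) := Fintype.ofFinite _
        refine (ncard_iUnion_le_mul _ _ (hpat s)).trans (le_of_eq ?_)
        rw [patternCount, Nat.card_eq_fintype_card]
        simp only [Fintype.card_prod, Fintype.card_fun, Fintype.card_fin]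
        push_cast
        ring
    _ = _ := by rw [failBound, Finset.sum_mul]

/-! ### Colourings with a small colour class are rare -/

open Classical in
/-- The structure obtained from `M` when the points of `J`, of colour `b`, get the colour `a`. The
relations between `J` and the class of colour `a` are transported by the involution `π`, which
maps that class into the class of colour `b`. The pairs `(j, x)` in `E` are recorded by the
repetition-free tuples with entries `j`, `x` and the points of `D ⊆ J`; these were monochromatic
for `γ` and cease to be so if `j ∈ J` and `x ∉ J`. -/
@[reducible] def recolour (γ : A → Fin l) (a : Fin l) (J D : Finset A) (π : A → A)
    (E : Finset (A × A)) (M : (relLanguage r).Structure A) : (relLanguage r).Structure A :=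
  ofRel fun k t =>
    if ∀ i, t i ∈ J ∨ γ (t i) = a then False
    else if ∀ i, t i ∈ J ∨ γ (π (t i)) = a then interp M k (fun i => π (t i))
    else if ∀ i j, γ (t i) = γ (t j) then
      Function.Injective t ∧ ∃ p ∈ E, Finset.univ.image t = insert p.2 (insert p.1 D)
    else interp M k t

section
variable {γ : A → Fin l} {a b : Fin l} {J J' D X : Finset A} {π : A → A}
  {E : Finset (A × A)} {M : (relLanguage r).Structure A} {I : Set (Fin ρ)}

open Classical in
theorem recolour_mem_colouredClass (hJ' : J' ⊆ J) (hE : E ⊆ J' ×ˢ X)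
    (hM : M ∈ colouredClass r I γ) :
    recolour γ a J D π E M ∈ colouredClass r I (fun x => if x ∈ J then a else γ x) := by
  refine ⟨fun k t ht hmono => ?_, fun k hk => ⟨fun t ht i j hij => ?_, fun t ht p => ?_⟩⟩
  · rw [recolour, interp_ofRel] at ht
    split_ifs at ht with h1 h2 h3
    · -- the transported tuple lies in the class of colour `a`
      refine hM.1 k _ ht fun i j => ?_
      by_cases hJt : ∃ i, t i ∈ J
      · obtain ⟨i₁, hi₁⟩ := hJt
        refine (h1 fun i => ?_).elim
        have := hmono i i₁
        simp only [hi₁, if_true] at this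
        by_cases hi : t i ∈ J
        · exact Or.inl hi
        · exact Or.inr (by simpa [hi] using this)
      · push Not at hJt
        rw [(h2 i).resolve_left (hJt i), (h2 j).resolve_left (hJt j)]
    · obtain ⟨-, p, hp, himg⟩ := ht
      have hp1 := hJ' (Finset.mem_product.1 (hE hp)).1
      have : p.1 ∈ Finset.univ.image t := by rw [himg]; simp
      obtain ⟨i₁, -, hi₁⟩ := Finset.mem_image.1 this
      refine h1 fun i => ?_
      have := hmono i i₁
      simp only [hi₁, hp1, if_true] at this
      by_cases hi : t i ∈ J
      · exact Or.inl hi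
      · exact Or.inr (by simpa [hi] using this)
    · by_cases hJt : ∃ i, t i ∈ J
      · obtain ⟨i₁, hi₁⟩ := hJt
        refine h1 fun i => ?_
        have := hmono i i₁
        simp only [hi₁, if_true] at this
        by_cases hi : t i ∈ J
        · exact Or.inl hi
        · exact Or.inr (by simpa [hi] using this)
      · push Not at hJt
        exact h3 fun i j => by simpa [hJt] using hmono i j
  · rw [recolour, interp_ofRel] at ht
    split_ifs at ht with h1 h2 h3
    · exact fun h => (hM.2 k hk).1 _ ht i j hij (congrArg π h)
    · exact fun h => hij (ht.1 h)
    · exact (hM.2 k hk).1 _ ht i j hij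
  · have himg : Finset.univ.image (fun i => t (p i)) = Finset.univ.image t := by
      ext x
      simp only [Finset.mem_image, Finset.mem_univ, true_and]
      exact (p.surjective.exists (p := fun i => t i = x)).symm
    have hinj : Function.Injective (fun i => t (p i)) ↔ Function.Injective t :=
      p.injective_comp t
    have e1 : (∀ i, t (p i) ∈ J ∨ γ (t (p i)) = a) ↔ ∀ i, t i ∈ J ∨ γ (t i) = a :=
      (p.surjective.forall (p := fun i => t i ∈ J ∨ γ (t i) = a)).symm
    have e2 : (∀ i, t (p i) ∈ J ∨ γ (π (t (p i))) = a) ↔ ∀ i, t i ∈ J ∨ γ (π (t i)) = a :=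
      (p.surjective.forall (p := fun i => t i ∈ J ∨ γ (π (t i)) = a)).symm
    have e3 : (∀ i j, γ (t (p i)) = γ (t (p j))) ↔ ∀ i j, γ (t i) = γ (t j) :=
      (p.surjective.forall₂ (p := fun i j => γ (t i) = γ (t j))).symm
    rw [recolour, interp_ofRel] at ht ⊢
    simp only [e1, e2, e3, himg, hinj]
    split_ifs at ht ⊢ with h1 h2 h3
    · exact (hM.2 k hk).2 _ ht p
    · exact ht
    · exact (hM.2 k hk).2 _ ht p

/-- The structure `M` is recovered from `recolour γ a J D π E M`: a tuple not monochromatic for `γ`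
is left as it was, or else it joins `J` to the class of colour `a` and is read off at its
`π`-image. -/
theorem recolour_structure_injective (hab : a ≠ b) (hJ : ∀ x ∈ J, γ x = b)
    (hπ : Function.Involutive π) (hπJ : ∀ x ∈ J, π x = x) (hπa : ∀ x, γ x = a → γ (π x) = b)
    (hπa' : ∀ x, γ x = a → π x ∉ J)
    {M' : (relLanguage r).Structure A} {E' : Finset (A × A)}
    (hM : M ∈ colouredClass r I γ) (hM' : M' ∈ colouredClass r I γ)
    (h : recolour γ a J D π E M = recolour γ a J D π E' M') : M = M' := by
  classical
  refine interp_ext fun k t => ?_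
  by_cases hmono : ∀ i j, γ (t i) = γ (t j)
  · exact iff_of_false (fun ht => hM.1 k t ht hmono) (fun ht => hM'.1 k t ht hmono)
  by_cases h1 : ∀ i, t i ∈ J ∨ γ (t i) = a
  · have h2 : ∀ i, π (t i) ∈ J ∨ γ (π (π (t i))) = a := by
      intro i
      rcases h1 i with hi | hi
      · exact Or.inl (by rwa [hπJ _ hi])
      · exact Or.inr (by rwa [hπ])
    have h3 : ¬ ∀ i, π (t i) ∈ J ∨ γ (π (t i)) = a := by
      intro h3
      refine hmono fun i j => ?_
      have : ∀ i, γ (t i) = b := by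
        intro i
        rcases h1 i with hi | hi
        · exact hJ _ hi
        · rcases h3 i with h4 | h4
          · exact (hπa' _ hi h4).elim
          · exact (hab (h4.symm.trans (hπa _ hi))).elim
      rw [this, this]
    have key : ∀ (M : (relLanguage r).Structure A) (E : Finset (A × A)),
        interp (recolour γ a J D π E M) k (fun i => π (t i)) ↔ interp M k t := by
      intro M E
      rw [recolour, interp_ofRel, if_neg h3, if_pos h2]
      simp only [hπ _]
    rw [← key M E, h, key]
  · have h2 : ¬ ∀ i, t i ∈ J ∨ γ (π (t i)) = a := by
      intro h2
      refine hmono fun i j => ?_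
      have : ∀ i, γ (t i) = b := by
        intro i
        rcases h2 i with hi | hi
        · exact hJ _ hi
        · rw [← hπ (t i)]
          exact hπa _ hi
      rw [this, this]
    have key : ∀ (M : (relLanguage r).Structure A) (E : Finset (A × A)),
        interp (recolour γ a J D π E M) k t ↔ interp M k t := by
      intro M E
      rw [recolour, interp_ofRel, if_neg h1, if_neg h2, if_neg hmono]
    rw [← key M E, h, key]

open Classical in
/-- The set `E` is recovered from `recolour γ a J D π E M`: whether `(j, x) ∈ E` is read off at any
enumeration of `{x, j} ∪ D`, and `j` and `x` are determined by this set, as `D`, `J'` and `X` are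
disjoint. -/
theorem recolour_pairs_subset (hab : a ≠ b) (hJ : ∀ x ∈ J, γ x = b)
    (hX : ∀ x ∈ X, γ x = b) (hXJ : Disjoint X J) (hJ' : J' ⊆ J) (hD : D ⊆ J)
    (hDJ' : Disjoint D J') {k : Fin ρ} (hk : D.card + 2 = r k)
    (hπX : ∀ x ∈ X, γ (π x) ≠ a)
    {M' : (relLanguage r).Structure A} {E' : Finset (A × A)} (hE : E ⊆ J' ×ˢ X)
    (hE' : E' ⊆ J' ×ˢ X)
    (h : recolour γ a J D π E M = recolour γ a J D π E' M') : E ⊆ E' := by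
  rintro ⟨j, x⟩ hp
  obtain ⟨hj, hx⟩ := Finset.mem_product.1 (hE hp)
  dsimp only at hj hx
  have hjD : j ∉ D := fun h => Finset.disjoint_left.1 hDJ' h hj
  have hxJ : x ∉ J := Finset.disjoint_left.1 hXJ hx
  have hxS : x ∉ insert j D := by
    intro h
    rcases Finset.mem_insert.1 h with rfl | h
    · exact hxJ (hJ' hj)
    · exact hxJ (hD h)
  have hcard : (insert x (insert j D)).card = r k := by
    rw [Finset.card_insert_of_notMem hxS, Finset.card_insert_of_notMem hjD]
    omega
  let e := (Finset.equivFinOfCardEq hcard).symm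
  let t : Fin (r k) → A := fun i => e i
  have htinj : Function.Injective t := Subtype.val_injective.comp e.injective
  have htimg : Finset.univ.image t = insert x (insert j D) := by
    ext z
    simp only [Finset.mem_image, Finset.mem_univ, true_and, t]
    refine ⟨fun ⟨i, hi⟩ => hi ▸ (e i).2, fun hz => ⟨e.symm ⟨z, hz⟩, by simp⟩⟩
  obtain ⟨i, hi⟩ : ∃ i, t i = x := by
    have : x ∈ Finset.univ.image t := by rw [htimg]; simp
    simpa using this
  have h1 : ¬ ∀ i, t i ∈ J ∨ γ (t i) = a := by
    intro h1
    rcases h1 i with h | h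
    · exact hxJ (hi ▸ h)
    · rw [hi, hX x hx] at h
      exact hab h.symm
  have h2 : ¬ ∀ i, t i ∈ J ∨ γ (π (t i)) = a := by
    intro h2
    rcases h2 i with h | h
    · exact hxJ (hi ▸ h)
    · rw [hi] at h
      exact hπX x hx h
  have h3 : ∀ i j, γ (t i) = γ (t j) := by
    have : ∀ i, γ (t i) = b := by
      intro i
      have : t i ∈ insert x (insert j D) := htimg ▸ Finset.mem_image_of_mem t (Finset.mem_univ i)
      rcases Finset.mem_insert.1 this with h | h
      · rw [h, hX x hx]
      · rcases Finset.mem_insert.1 h with h | h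
        · rw [h, hJ _ (hJ' hj)]
        · exact hJ _ (hD h)
    intro i j
    rw [this, this]
  have key : ∀ (M : (relLanguage r).Structure A) (E : Finset (A × A)),
      interp (recolour γ a J D π E M) k t ↔
        ∃ p ∈ E, insert x (insert j D) = insert p.2 (insert p.1 D) := by
    intro M E
    rw [recolour, interp_ofRel, if_neg h1, if_neg h2, if_pos h3, htimg]
    exact and_iff_right htinj
  obtain ⟨⟨j', x'⟩, hp', heq⟩ := (key M' E').1 (h ▸ (key M E).2 ⟨(j, x), hp, rfl⟩)
  obtain ⟨hj', hx'⟩ := Finset.mem_product.1 (hE' hp')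
  dsimp only at hj' hx' heq
  have hxx : x = x' := by
    have : x ∈ insert x' (insert j' D) := heq ▸ Finset.mem_insert_self _ _
    rcases Finset.mem_insert.1 this with h | h
    · exact h
    · rcases Finset.mem_insert.1 h with h | h
      · exact (hxJ (h ▸ hJ' hj')).elim
      · exact (hxJ (hD h)).elim
  have hjj : j = j' := by
    have : j ∈ insert x' (insert j' D) :=
      heq ▸ Finset.mem_insert_of_mem (Finset.mem_insert_self _ _)
    rcases Finset.mem_insert.1 this with h | h
    · exact (Finset.disjoint_left.1 hXJ hx' (h ▸ hJ' hj)).elim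
    · rcases Finset.mem_insert.1 h with h | h
      · exact h
      · exact (hjD h).elim
  rw [hxx, hjj]
  exact hp'

end

/-- A colouring with a class of fewer than `u` and a class of at least `4 * u` points is worse by
a factor `2 ^ (u * u)` than the one in which `u` or more points change from the large to the small
class. -/
theorem exists_better_colouring [Fintype A] (hr : ∀ k, 2 ≤ r k) (I : Set (Fin ρ)) (k : Fin ρ)
    (γ : A → Fin l) (a b : Fin l) {u : ℕ} (hu : r k ≤ u)
    (ha : (Finset.univ.filter fun x => γ x = a).card < u)
    (hb : 4 * u ≤ (Finset.univ.filter fun x => γ x = b).card) :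
    ∃ γ' : A → Fin l,
      2 ^ (u * u) * (colouredClass r I γ).ncard ≤ (colouredClass r I γ').ncard := by
  classical
  have hab : a ≠ b := by
    rintro rfl
    omega
  set Sa := Finset.univ.filter fun x => γ x = a with hSa
  set Sb := Finset.univ.filter fun x => γ x = b with hSb
  obtain ⟨P, hPb, hPc⟩ := Finset.exists_subset_card_eq (s := Sb) (n := Sa.card) (by omega)
  have h1 := Finset.card_sdiff_add_card_eq_card hPb
  obtain ⟨X, hXb, hXc⟩ := Finset.exists_subset_card_eq (s := Sb \ P) (n := u) (by omega)
  have h2 := Finset.card_sdiff_add_card_eq_card hXb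
  obtain ⟨J', hJ'b, hJ'c⟩ := Finset.exists_subset_card_eq (s := (Sb \ P) \ X) (n := u) (by omega)
  have h3 := Finset.card_sdiff_add_card_eq_card hJ'b
  obtain ⟨D, hDb, hDc⟩ := Finset.exists_subset_card_eq (s := ((Sb \ P) \ X) \ J')
    (n := r k - 2) (by omega)
  -- `D ∪ J'` is the set of points to be moved
  have hrk := hr k
  have hSa' : ∀ x, x ∈ Sa ↔ γ x = a := by simp [hSa]
  have hSb' : ∀ x, x ∈ Sb ↔ γ x = b := by simp [hSb]
  have hP : ∀ x ∈ P, γ x = b := fun x hx => (hSb' x).1 (hPb hx)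
  have hX : ∀ x ∈ X, γ x = b ∧ x ∉ P := fun x hx => by
    have := hXb hx
    rwa [Finset.mem_sdiff, hSb'] at this
  have hJ' : ∀ x ∈ J', (γ x = b ∧ x ∉ P) ∧ x ∉ X := fun x hx => by
    have := hJ'b hx
    rwa [Finset.mem_sdiff, Finset.mem_sdiff, hSb'] at this
  have hD : ∀ x ∈ D, ((γ x = b ∧ x ∉ P) ∧ x ∉ X) ∧ x ∉ J' := fun x hx => by
    have := hDb hx
    rwa [Finset.mem_sdiff, Finset.mem_sdiff, Finset.mem_sdiff, hSb'] at this
  have hJ : ∀ x ∈ D ∪ J', (γ x = b ∧ x ∉ P) ∧ x ∉ X := fun x hx => by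
    rcases Finset.mem_union.1 hx with hx | hx
    · exact (hD x hx).1
    · exact hJ' x hx
  -- the involution that exchanges the small class with `P`
  obtain ⟨π, hπ, hπ1, hπ2, hπ3⟩ : ∃ π : A → A, Function.Involutive π ∧
      (∀ x, γ x = a → π x ∈ P) ∧ (∀ x ∈ P, γ (π x) = a) ∧
        ∀ x, γ x ≠ a → x ∉ P → π x = x := by
    let e : Sa ≃ P := Finset.equivOfCardEq hPc.symm
    let π : A → A := fun x =>
      if h : x ∈ Sa then e ⟨x, h⟩ else if h : x ∈ P then e.symm ⟨x, h⟩ else x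
    have hPa : ∀ x ∈ P, x ∉ Sa := fun x hx h => hab (((hSa' x).1 h).symm.trans (hP x hx))
    have e1 : ∀ x (h : x ∈ Sa), π x = e ⟨x, h⟩ := fun x h => dif_pos h
    have e2 : ∀ x (h : x ∈ P), π x = e.symm ⟨x, h⟩ := fun x h => by
      simp only [π, dif_neg (hPa x h), dif_pos h]
    have e3 : ∀ x, x ∉ Sa → x ∉ P → π x = x := fun x h h' => by
      simp only [π, dif_neg h, dif_neg h']
    refine ⟨π, fun x => ?_, fun x hx => ?_, fun x hx => ?_, fun x hx => ?_⟩
    · by_cases h : x ∈ Sa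
      · rw [e1 x h, e2 _ (e ⟨x, h⟩).2]
        simp
      · by_cases h' : x ∈ P
        · rw [e2 x h', e1 _ (e.symm ⟨x, h'⟩).2]
          simp
        · rw [e3 x h h', e3 x h h']
    · rw [e1 x ((hSa' x).2 hx)]
      exact (e _).2
    · rw [e2 x hx]
      exact (hSa' _).1 (e.symm _).2
    · exact e3 x fun h => hx ((hSa' x).1 h)
  have hne : ∀ x, γ x = b → γ x ≠ a := fun x h h' => hab (h'.symm.trans h)
  refine ⟨fun x => if x ∈ D ∪ J' then a else γ x, ?_⟩
  have hpow : 2 ^ (u * u) = (((J' ×ˢ X).powerset : Finset (Finset (A × A))) :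
      Set (Finset (A × A))).ncard := by
    rw [Set.ncard_coe_finset, Finset.card_powerset, Finset.card_product, hJ'c, hXc]
  rw [hpow, ← Set.ncard_prod]
  refine Set.ncard_le_ncard_of_injOn (fun q => recolour γ a (D ∪ J') D π q.1 q.2) ?_ ?_
  · rintro ⟨E, M⟩ ⟨hE, hM⟩
    exact recolour_mem_colouredClass Finset.subset_union_right (Finset.mem_powerset.1 hE) hM
  · rintro ⟨E, M⟩ ⟨hE, hM⟩ ⟨E', M'⟩ ⟨hE', hM'⟩ h
    have hEs := Finset.mem_powerset.1 hE
    have hEs' := Finset.mem_powerset.1 hE'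
    have hpairs : ∀ {E E' : Finset (A × A)} {M M' : (relLanguage r).Structure A},
        E ⊆ J' ×ˢ X → E' ⊆ J' ×ˢ X →
        recolour γ a (D ∪ J') D π E M = recolour γ a (D ∪ J') D π E' M' → E ⊆ E' := by
      intro E E' M M' hE hE' h
      refine recolour_pairs_subset (k := k) hab (fun x hx => (hJ x hx).1.1)
        (fun x hx => (hX x hx).1) ?_ Finset.subset_union_right Finset.subset_union_left ?_
        (by omega) ?_ hE hE' h
      · exact Finset.disjoint_left.2 fun x hx hx' => (hJ x hx').2 hx
      · exact Finset.disjoint_left.2 fun x hx hx' => (hD x hx).2 hx'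
      · intro x hx
        rw [hπ3 x (hne x (hX x hx).1) (hX x hx).2]
        exact hne x (hX x hx).1
    refine Prod.ext ((hpairs hEs hEs' h).antisymm (hpairs hEs' hEs h.symm)) ?_
    refine recolour_structure_injective hab (fun x hx => (hJ x hx).1.1) hπ ?_ ?_ ?_ hM hM' h
    · exact fun x hx => hπ3 x (hne x (hJ x hx).1.1) (hJ x hx).1.2
    · exact fun x hx => hP _ (hπ1 x hx)
    · exact fun x hx h => (hJ _ h).1.2 (hπ1 x hx)

/-! ### From fixed colourings to the uniform measure -/

theorem ncard_pos_colourableClass (hl : 0 < l) (I : Set (Fin ρ)) (n : ℕ) :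
    0 < ((colourableClass r l I n).ncard : ℝ) :=
  Nat.cast_pos.2 ((Set.ncard_pos (Set.toFinite _)).2 (colourableClass_nonempty r hl I n))

theorem proportion_le_one (I : Set (Fin ρ)) (P : ∀ n : ℕ, (relLanguage r).Structure (Fin n) → Prop)
    (n : ℕ) : proportion r l I P n ≤ 1 :=
  div_le_one_of_le₀ (Nat.cast_le.2 (Set.ncard_le_ncard (fun _ h => h.1) (Set.toFinite _)))
    (Nat.cast_nonneg _)

theorem AlmostAll.mono {I : Set (Fin ρ)}
    {P Q : ∀ n : ℕ, (relLanguage r).Structure (Fin n) → Prop} (h : AlmostAll r l I P)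
    (hPQ : ∀ n, ∀ M ∈ colourableClass r l I n, P n M → Q n M) : AlmostAll r l I Q := by
  refine tendsto_of_tendsto_of_tendsto_of_le_of_le h tendsto_const_nhds (fun n => ?_)
    (proportion_le_one I Q)
  refine div_le_div_of_nonneg_right (Nat.cast_le.2 ?_) (Nat.cast_nonneg _)
  exact Set.ncard_le_ncard (fun M hM => ⟨hM.1, hPQ n M hM.1 hM.2⟩) (Set.toFinite _)

theorem almostAll_of_ncard_not_le (hl : 0 < l) {I : Set (Fin ρ)}
    {P : ∀ n : ℕ, (relLanguage r).Structure (Fin n) → Prop} {β : ℕ → ℝ}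
    (hβ : Tendsto β atTop (𝓝 0))
    (h : ∀ᶠ n in atTop, ({M ∈ colourableClass r l I n | ¬ P n M}.ncard : ℝ) ≤
      β n * (colourableClass r l I n).ncard) : AlmostAll r l I P := by
  have h1 : Tendsto (fun n => 1 - β n) atTop (𝓝 1) := by simpa using hβ.const_sub 1
  refine tendsto_of_tendsto_of_tendsto_of_le_of_le' h1 tendsto_const_nhds ?_
    (Eventually.of_forall (proportion_le_one I P))
  filter_upwards [h] with n hn
  have hpos := ncard_pos_colourableClass (r := r) hl I n
  have hsum : {M ∈ colourableClass r l I n | P n M}.ncard +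
      {M ∈ colourableClass r l I n | ¬ P n M}.ncard = (colourableClass r l I n).ncard := by
    rw [← Set.ncard_inter_add_ncard_sdiff_eq_ncard (colourableClass r l I n) {M | P n M}
      (Set.toFinite _)]
    rfl
  have hsum' : ({M ∈ colourableClass r l I n | P n M}.ncard : ℝ) +
      {M ∈ colourableClass r l I n | ¬ P n M}.ncard = (colourableClass r l I n).ncard := by
    exact_mod_cast hsum
  rw [proportion, le_div_iff₀ hpos]
  linarith

/-- All colour classes of `γ` have at least `n / (4 * l)` elements. -/
def IsRich {n : ℕ} (γ : Fin n → Fin l) : Prop :=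
  ∀ c, n / (4 * l) ≤ (Finset.univ.filter fun y => γ y = c).card

theorem ncard_colouredClass_le_of_not_isRich (hr : ∀ k, 2 ≤ r k) (I : Set (Fin ρ)) (k : Fin ρ)
    {n : ℕ} (hn : r k ≤ n / (4 * l)) {γ : Fin n → Fin l} (hγ : ¬ IsRich γ) :
    2 ^ (n / (4 * l) * (n / (4 * l))) * (colouredClass r I γ).ncard ≤
      (colourableClass r l I n).ncard := by
  simp only [IsRich, not_forall, not_le] at hγ
  obtain ⟨a, ha⟩ := hγ
  obtain ⟨b, -, hb⟩ := Finset.exists_le_card_fiber_of_mul_le_card_of_maps_to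
    (s := (Finset.univ : Finset (Fin n))) (t := (Finset.univ : Finset (Fin l))) (f := γ)
    (n := 4 * (n / (4 * l))) (fun _ _ => Finset.mem_univ _) ⟨a, Finset.mem_univ _⟩ (by
      simp only [Finset.card_univ, Fintype.card_fin]
      calc l * (4 * (n / (4 * l))) = 4 * l * (n / (4 * l)) := by ring
        _ ≤ n := Nat.mul_div_le _ _)
  obtain ⟨γ', h⟩ := exists_better_colouring hr I k γ a b hn ha hb
  exact h.trans (Set.ncard_le_ncard (fun M hM => ⟨⟨γ', hM.1⟩, hM.2⟩) (Set.toFinite _))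

theorem ncard_exists_not_isRich_le (hr : ∀ k, 2 ≤ r k) (I : Set (Fin ρ)) (k : Fin ρ)
    {n : ℕ} (hn : r k ≤ n / (4 * l)) :
    ((⋃ γ : {γ : Fin n → Fin l // ¬ IsRich γ}, colouredClass r I γ.1).ncard : ℝ) ≤
      (l : ℝ) ^ n / 2 ^ (n / (4 * l) * (n / (4 * l))) * (colourableClass r l I n).ncard := by
  classical
  have hbound : ∀ γ : {γ : Fin n → Fin l // ¬ IsRich γ}, ((colouredClass r I γ.1).ncard : ℝ) ≤
      (colourableClass r l I n).ncard / 2 ^ (n / (4 * l) * (n / (4 * l))) := by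
    intro γ
    rw [le_div_iff₀ (by positivity), mul_comm]
    exact_mod_cast ncard_colouredClass_le_of_not_isRich hr I k hn γ.2
  refine (ncard_iUnion_le_mul _ _ hbound).trans ?_
  have hcard : (Fintype.card {γ : Fin n → Fin l // ¬ IsRich γ} : ℝ) ≤ (l : ℝ) ^ n := by
    have := Fintype.card_subtype_le (fun γ : Fin n → Fin l => ¬ IsRich γ)
    simp only [Fintype.card_fun, Fintype.card_fin] at this
    exact_mod_cast this
  rw [div_mul_eq_mul_div, ← mul_div_assoc]
  gcongr

/-- A structure with the extension property has at most `l ^ l` colourings, since they all have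
the same classes. -/
theorem sum_ncard_hasExtension_le (hl : 0 < l) {k : Fin ρ} (hk : 2 ≤ r k) (I : Set (Fin ρ)) {m : ℕ}
    (hm : l * (r k - 1) + 1 < m) (n : ℕ) :
    ∑ γ : Fin n → Fin l, {M ∈ colouredClass r I γ | HasExtension I (2 + l * m) M γ}.ncard ≤
      l ^ l * (colourableClass r l I n).ncard := by
  classical
  let S : (Fin n → Fin l) → Set ((relLanguage r).Structure (Fin n)) :=
    fun γ => {M ∈ colouredClass r I γ | HasExtension I (2 + l * m) M γ}
  have hmem : ∀ γ M, M ∈ (S γ).toFinite.toFinset ↔ M ∈ S γ := fun γ M => by simp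
  have h1 : ∀ γ, (S γ).ncard = (S γ).toFinite.toFinset.card := fun γ =>
    Set.ncard_eq_toFinset_card _ _
  have h2 : (colourableClass r l I n).ncard =
    (colourableClass r l I n).toFinite.toFinset.card := Set.ncard_eq_toFinset_card _ _
  have h3 : l ^ l = (Finset.univ : Finset (Fin l → Fin l)).card := by simp
  change ∑ γ : Fin n → Fin l, (S γ).ncard ≤ _
  simp only [h1]
  rw [h2, h3, ← Finset.card_sigma, ← Finset.card_product]
  -- a reference colouring with the extension property, where there is one
  obtain ⟨γ₀, hγ₀⟩ : ∃ γ₀ : (relLanguage r).Structure (Fin n) → (Fin n → Fin l),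
      ∀ M γ, M ∈ S γ → M ∈ S (γ₀ M) := by
    have : ∀ M : (relLanguage r).Structure (Fin n), ∃ γ₀ : Fin n → Fin l,
        ∀ γ, M ∈ S γ → M ∈ S γ₀ := by
      intro M
      by_cases h : ∃ γ, M ∈ S γ
      · exact ⟨h.choose, fun _ _ => h.choose_spec⟩
      · exact ⟨fun _ => ⟨0, hl⟩, fun γ hγ => (h ⟨γ, hγ⟩).elim⟩
    choose γ₀ h using this
    exact ⟨γ₀, h⟩
  have hfac : ∀ M γ, M ∈ S γ → γ.FactorsThrough (γ₀ M) := by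
    intro M γ hM a b hab
    have hM₀ := hγ₀ M γ hM
    have key := fun γ' hγ' => HasExtension.sameColour_iff (i₀ := ⟨0, hl⟩)
      (j₀ := ⟨0, by omega⟩) (j₁ := ⟨1, by omega⟩) hk (by omega : l * (r k - 1) < m)
      hM₀.1.1 hM₀.2 (by simp) (γ' := γ') hγ' a b
    exact (key γ hM.1.1).2 ((key (γ₀ M) hM₀.1.1).1 hab)
  refine Finset.card_le_card_of_injOn
    (fun q => (Function.extend (γ₀ q.2) q.1 id, q.2)) ?_ ?_
  · rintro ⟨γ, M⟩ hq
    have hM := (hmem γ M).1 (Finset.mem_sigma.1 hq).2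
    simp only [Finset.coe_product, Finset.coe_univ, Set.Finite.coe_toFinset]
    exact ⟨trivial, ⟨γ, hM.1.1⟩, hM.1.2⟩
  · rintro ⟨γ, M⟩ hq ⟨γ', M'⟩ hq' h
    have hM := (hmem γ M).1 (Finset.mem_sigma.1 hq).2
    have hM' := (hmem γ' M').1 (Finset.mem_sigma.1 hq').2
    obtain ⟨h5, rfl⟩ := Prod.ext_iff.1 h
    dsimp only at h5 hM hM'
    have : γ = γ' := by
      funext a
      rw [← (hfac M γ hM).extend_apply id a, h5, (hfac M γ' hM').extend_apply]
    rw [this]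

theorem tendsto_div_four_mul (hl : 0 < l) : Tendsto (fun n : ℕ => n / (4 * l)) atTop atTop :=
  Nat.tendsto_div_const_atTop (by omega)

theorem le_four_mul_mul (hl : 0 < l) (n : ℕ) : n ≤ 4 * l * (n / (4 * l) + 1) :=
  (Nat.lt_mul_div_succ n (by omega)).le

theorem tendsto_pow_div_two_pow_sq (hl : 0 < l) :
    Tendsto (fun n : ℕ => (l : ℝ) ^ n / 2 ^ (n / (4 * l) * (n / (4 * l)))) atTop (𝓝 0) := by
  have hl1 : (1 : ℝ) ≤ l := by exact_mod_cast hl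
  set L : ℝ := (l : ℝ) ^ (4 * l) with hL
  have hL1 : 1 ≤ L := one_le_pow₀ hl1
  have h2 : Tendsto (fun u : ℕ => (2 : ℝ) ^ u) atTop atTop :=
    tendsto_pow_atTop_atTop_of_one_lt (by norm_num)
  have hhalf : Tendsto (fun n : ℕ => (1 / 2 : ℝ) ^ (n / (4 * l))) atTop (𝓝 0) :=
    (tendsto_pow_atTop_nhds_zero_of_lt_one (by norm_num) (by norm_num)).comp
      (tendsto_div_four_mul hl)
  refine squeeze_zero' (Eventually.of_forall fun n => by positivity) ?_ hhalf
  have hev := (tendsto_div_four_mul hl).eventually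
    ((h2.eventually_ge_atTop (2 * (L * L))).and (eventually_ge_atTop 1))
  filter_upwards [hev] with n hn
  obtain ⟨hn1, hn2⟩ := hn
  set u := n / (4 * l) with hu
  have hlu : (l : ℝ) ^ n ≤ (L * L) ^ u := by
    calc (l : ℝ) ^ n ≤ (l : ℝ) ^ (4 * l * (u + 1)) := pow_le_pow_right₀ hl1 (le_four_mul_mul hl n)
      _ = L ^ (u + 1) := by rw [hL, pow_mul]
      _ ≤ L ^ (2 * u) := pow_le_pow_right₀ hL1 (by omega)
      _ = (L * L) ^ u := by rw [pow_mul, sq]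
  rw [pow_mul, div_le_iff₀ (by positivity), ← mul_pow]
  refine hlu.trans (pow_le_pow_left₀ (by positivity) ?_ u)
  linarith

theorem tendsto_failBound (hl : 0 < l) (K : ℕ) :
    Tendsto (fun n : ℕ => failBound r l K n (n / (4 * l))) atTop (𝓝 0) := by
  have hterm : ∀ s, Tendsto (fun n : ℕ => (n : ℝ) ^ s * l * patternCount r s *
      failRate r s ^ (n / (4 * l) - s)) atTop (𝓝 0) := by
    intro s
    set q := failRate r s with hq
    have hq0 : 0 < q := failRate_pos r s
    have hq1 : q < 1 := failRate_lt_one r s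
    have hp : 0 ≤ patternCount r s := Nat.cast_nonneg _
    have h1 : Tendsto (fun n : ℕ => ((n / (4 * l) + 1 : ℕ) : ℝ) ^ s * q ^ (n / (4 * l) + 1))
        atTop (𝓝 0) :=
      (tendsto_pow_const_mul_const_pow_of_abs_lt_one s (by rwa [abs_of_pos hq0])).comp
        ((tendsto_add_atTop_nat 1).comp (tendsto_div_four_mul hl))
    have h2 := h1.const_mul ((4 * l : ℝ) ^ s * l * patternCount r s / q ^ (s + 1))
    rw [mul_zero] at h2
    refine squeeze_zero (fun n => by positivity) (fun n => ?_) h2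
    set u := n / (4 * l) with hu
    have hn : (n : ℝ) ≤ 4 * l * ((u + 1 : ℕ) : ℝ) := by exact_mod_cast le_four_mul_mul hl n
    have hqu : q ^ (u - s) ≤ q ^ (u + 1) / q ^ (s + 1) := by
      rw [le_div_iff₀ (by positivity), ← pow_add]
      exact pow_le_pow_of_le_one hq0.le hq1.le (by omega)
    calc (n : ℝ) ^ s * l * patternCount r s * q ^ (u - s)
        ≤ (4 * l * ((u + 1 : ℕ) : ℝ)) ^ s * l * patternCount r s *
          (q ^ (u + 1) / q ^ (s + 1)) := by gcongr
      _ = _ := by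
        rw [mul_pow]
        ring
  have := tendsto_finsetSum (Finset.range (K + 1)) fun s _ => hterm s
  simpa only [failBound, Finset.sum_const_zero] using this

open Classical in
/-- Counting pairs of a structure and a rich colouring of it: up to the factor `2 * l ^ l` there
are no more of them than structures, since almost all of the pairs have the extension property. -/
theorem eventually_sum_ncard_isRich_le (hl : 0 < l) (hr : ∀ k, 2 ≤ r k) (I : Set (Fin ρ))
    (k : Fin ρ) : ∀ᶠ n in atTop, ∑ γ : {γ : Fin n → Fin l // IsRich γ},
      ((colouredClass r I γ.1).ncard : ℝ) ≤ 2 * (l : ℝ) ^ l * (colourableClass r l I n).ncard := by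
  set K := 2 + l * (l * (r k - 1) + 2) with hK
  filter_upwards [(tendsto_failBound (r := r) hl K).eventually_le_const
    (by norm_num : (0 : ℝ) < 1 / 2)] with n hn
  have h1 : ∀ γ : {γ : Fin n → Fin l // IsRich γ}, ((colouredClass r I γ.1).ncard : ℝ) ≤
      2 * ({M ∈ colouredClass r I γ.1 | HasExtension I K M γ.1}.ncard : ℝ) := by
    intro γ
    have h2 := ncard_not_hasExtension_le (r := r) I K n _ γ.1 γ.2
    have h3 : {M ∈ colouredClass r I γ.1 | HasExtension I K M γ.1}.ncard +
        {M ∈ colouredClass r I γ.1 | ¬ HasExtension I K M γ.1}.ncard =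
          (colouredClass r I γ.1).ncard := by
      rw [← Set.ncard_inter_add_ncard_sdiff_eq_ncard (colouredClass r I γ.1)
        {M | HasExtension I K M γ.1} (Set.toFinite _)]
      rfl
    have h4 : ({M ∈ colouredClass r I γ.1 | HasExtension I K M γ.1}.ncard : ℝ) +
        {M ∈ colouredClass r I γ.1 | ¬ HasExtension I K M γ.1}.ncard =
          (colouredClass r I γ.1).ncard := by exact_mod_cast h3
    have h5 := mul_le_mul_of_nonneg_right hn
      (Nat.cast_nonneg (α := ℝ) (colouredClass r I γ.1).ncard)
    linarith
  refine (Finset.sum_le_sum fun γ _ => h1 γ).trans ?_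
  rw [← Finset.mul_sum, mul_assoc]
  refine mul_le_mul_of_nonneg_left ?_ (by norm_num)
  have h6 := sum_ncard_hasExtension_le hl (hr k) I (m := l * (r k - 1) + 2) (by omega) n
  have h7 : ∑ γ : {γ : Fin n → Fin l // IsRich γ},
      {M ∈ colouredClass r I γ.1 | HasExtension I K M γ.1}.ncard ≤
      ∑ γ : Fin n → Fin l, {M ∈ colouredClass r I γ | HasExtension I K M γ}.ncard := by
    rw [← Finset.sum_subtype (Finset.univ.filter fun γ : Fin n → Fin l => IsRich γ) (by simp)
      (fun γ => {M ∈ colouredClass r I γ | HasExtension I K M γ}.ncard)]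
    exact Finset.sum_le_sum_of_subset (Finset.filter_subset _ _)
  exact_mod_cast h7.trans h6

/-- Almost all structures in the class have a colouring with the extension property. -/
theorem almostAll_exists_hasExtension (hl : 0 < l) (hr : ∀ k, 2 ≤ r k) (I : Set (Fin ρ))
    (k : Fin ρ) (K : ℕ) : AlmostAll r l I
      (fun _ M => ∃ γ : _ → Fin l, IsColouring M γ ∧ HasExtension I K M γ) := by
  classical
  refine almostAll_of_ncard_not_le (β := fun n =>
    (l : ℝ) ^ n / 2 ^ (n / (4 * l) * (n / (4 * l))) +
      failBound r l K n (n / (4 * l)) * (2 * (l : ℝ) ^ l)) hl ?_ ?_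
  · simpa using (tendsto_pow_div_two_pow_sq hl).add
      ((tendsto_failBound (r := r) hl K).mul_const (2 * (l : ℝ) ^ l))
  filter_upwards [eventually_sum_ncard_isRich_le hl hr I k,
    (tendsto_div_four_mul hl).eventually_ge_atTop (r k)] with n hn1 hn2
  have hsub : {M ∈ colourableClass r l I n |
      ¬ ∃ γ : Fin n → Fin l, IsColouring M γ ∧ HasExtension I K M γ} ⊆
      (⋃ γ : {γ : Fin n → Fin l // ¬ IsRich γ}, colouredClass r I γ.1) ∪
      ⋃ γ : {γ : Fin n → Fin l // IsRich γ},
        {M ∈ colouredClass r I γ.1 | ¬ HasExtension I K M γ.1} := by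
    rintro M ⟨⟨⟨γ, hγ⟩, hI⟩, hM⟩
    by_cases h : IsRich γ
    · exact Or.inr (Set.mem_iUnion.2 ⟨⟨γ, h⟩, ⟨hγ, hI⟩, fun hE => hM ⟨γ, hγ, hE⟩⟩)
    · exact Or.inl (Set.mem_iUnion.2 ⟨⟨γ, h⟩, hγ, hI⟩)
  have hfail : 0 ≤ failBound r l K n (n / (4 * l)) := by
    refine Finset.sum_nonneg fun s _ => ?_
    have := (failRate_pos r s).le
    have : 0 ≤ patternCount r s := Nat.cast_nonneg _
    positivity
  calc _ ≤ (((⋃ γ : {γ : Fin n → Fin l // ¬ IsRich γ}, colouredClass r I γ.1).ncard +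
      (⋃ γ : {γ : Fin n → Fin l // IsRich γ},
        {M ∈ colouredClass r I γ.1 | ¬ HasExtension I K M γ.1}).ncard : ℕ) : ℝ) :=
        Nat.cast_le.2 ((Set.ncard_le_ncard hsub (Set.toFinite _)).trans (Set.ncard_union_le _ _))
    _ ≤ (l : ℝ) ^ n / 2 ^ (n / (4 * l) * (n / (4 * l))) * (colourableClass r l I n).ncard +
      ∑ γ : {γ : Fin n → Fin l // IsRich γ},
        failBound r l K n (n / (4 * l)) * ((colouredClass r I γ.1).ncard : ℝ) := by
        rw [Nat.cast_add]
        refine add_le_add (ncard_exists_not_isRich_le hr I k hn2) ?_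
        refine (Nat.cast_le.2 (Set.ncard_iUnion_le_of_fintype _)).trans ?_
        rw [Nat.cast_sum]
        exact Finset.sum_le_sum fun γ _ => ncard_not_hasExtension_le I K n _ γ.1 γ.2
    _ ≤ _ := by
        rw [← Finset.mul_sum, add_mul, mul_assoc (failBound r l K n (n / (4 * l)))]
        gcongr

theorem hasZeroOneLaw (hl : 0 < l) (hr : ∀ k, 2 ≤ r k) (I : Set (Fin ρ)) (k : Fin ρ) :
    HasZeroOneLaw r l I := by
  intro φ
  obtain ⟨K, hK⟩ := exists_extension_transfer l I φ
  have hall := almostAll_exists_hasExtension hl hr I k K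
  have htransfer : ∀ (n n' : ℕ) (M : (relLanguage r).Structure (Fin n))
      (M' : (relLanguage r).Structure (Fin n')) (γ : Fin n → Fin l) (γ' : Fin n' → Fin l),
      M ∈ colouredClass r I γ → M' ∈ colouredClass r I γ' → HasExtension I K M γ →
      HasExtension I K M' γ' → (Satisfies M φ ↔ Satisfies M' φ) := by
    intro n n' M M' γ γ' hM hM' hE hE'
    refine hK _ _ M M' γ γ' hM.2 hM'.2 hM.1 hM'.1 hE hE' _ _ _ _ ⟨fun i => i.elim0,
      fun i => i.elim0, fun k t => (t ⟨0, by have := hr k; omega⟩).elim0⟩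
  by_cases h : ∃ (n : ℕ) (M : (relLanguage r).Structure (Fin n)) (γ : Fin n → Fin l),
      M ∈ colouredClass r I γ ∧ HasExtension I K M γ ∧ Satisfies M φ
  · obtain ⟨n', M', γ', hM', hE', hφ⟩ := h
    refine Or.inl (hall.mono fun n M hM ⟨γ, hγ, hE⟩ => ?_)
    exact (htransfer n n' M M' γ γ' ⟨hγ, hM.2⟩ hM' hE hE').2 hφ
  · refine Or.inr (hall.mono fun n M hM ⟨γ, hγ, hE⟩ => ?_)
    exact fun hφ => h ⟨n, M, γ, ⟨hγ, hM.2⟩, hE, hφ⟩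

end ColourableStructures

theorem mainTheorem1 (l : ℕ) (hl : 2 ≤ l) (ρ : ℕ) (hρ : 0 < ρ) (r : Fin ρ → ℕ)
    (hr : ∀ k, 2 ≤ r k) (I : Set (Fin ρ)) :
    (∃ ξ : (ColourableStructures.relLanguage r).Formula (Fin 2),
      ColourableStructures.AlmostAll r l I (fun n M =>
        ∀ γ : Fin n → Fin l, ColourableStructures.IsColouring M γ →
          ∀ a b : Fin n, γ a = γ b ↔ ColourableStructures.SatisfiesAt M ξ a b)) ∧
    ColourableStructures.AlmostAll r l I
      (fun _ M => ColourableStructures.IsUniquelyColourable l M) ∧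
    ColourableStructures.HasZeroOneLaw r l I := by
  have hl0 : 0 < l := by omega
  let k : Fin ρ := ⟨0, hρ⟩
  let m := l * (r k - 1) + 2
  let ξ := ColourableStructures.sameColour r k l m
    (⟨0, hl0⟩, ⟨0, by omega⟩) (⟨0, hl0⟩, ⟨1, by omega⟩)
  have hξ : ColourableStructures.AlmostAll r l I (fun n M =>
      ∀ γ : Fin n → Fin l, ColourableStructures.IsColouring M γ →
        ∀ a b : Fin n, γ a = γ b ↔ ColourableStructures.SatisfiesAt M ξ a b) := by
    refine (ColourableStructures.almostAll_exists_hasExtension hl0 hr I k (2 + l * m)).mono ?_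
    rintro n M - ⟨γ, hγ, hE⟩ γ' hγ' a b
    exact hE.sameColour_iff (hr k) (by omega) hγ (by simp) hγ' a b
  refine ⟨⟨ξ, hξ⟩, hξ.mono fun n M hM h => ⟨hM.1, fun γ γ' hγ hγ' a b => ?_⟩,
    ColourableStructures.hasZeroOneLaw hl0 hr I k⟩
  rw [h γ hγ, h γ' hγ']
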